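/- For integers $d\ge 2$ and $w\ge 1$, let $G_d^w$ be the multigraph obtained from the $2\times d$ grid graph (ladder) by replacing every edge with $w$ parallel copies. Let $n=2d$ and $m=w(3d-2)$ be its numbers of vertices and edges, and let $\lambda$ be its edge connectivity. A *greedy tree packing* of a connected multigraph $G=(V,E)$ is a sequence of spanning trees $B_1,B_2,\dots$ such that, for every $k\ge 0$, $B_{k+1}$ is a minimum weight spanning tree for the edge weights $e\mapsto |\{i\le k : e\in B_i\}|$. Ties are broken by a fixed ordering of $E$ if, among all minimum weight spanning trees, $B_{k+1}$ always minimizes the sum of the positions of its edges in that ordering. The vector of relative loads is $x^k\in\mathbb{R}^E$, $x^k_e=\frac1k|\{i\le k: e\in B_i\}|$, and the ideal loads vector is $x^*=\lim_{k\to\infty}x^k$. **Theorem.** There are absolute constants $c,C>0$ such that for all $d\ge 2$ and $w\ge 1$ the following holds. The graph $G_d^w$ has edge connectivity $\lambda=2w$. Moreover, there are an ordering of its edges and a greedy tree packing of $G_d^w$ with ties broken by this ordering for which the limit $x^*$ exists and $$\|x^k-x^*\|_\infty\ \ge\ c\,\sqrt{\frac{1}{k\lambda}}\qquad\text{for all integers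 } 1\le k\le C n^2 .$$ For the same $k$, the error is at least $\frac{c}{\sqrt{\log m}}$ times the value $\sqrt{\frac{6\log m}{k\lambda}}$ of Thorup's upper bound, so the lower bound matches it up to a factor $O(\sqrt{\log m})$. -/

import Mathlib

open Filter Topology

namespace TreePacking

variable {α β : Type*}

/-- A multigraph is connected: it has a vertex, and any two vertices are joined by a walk. -/
def IsConnected (G : Graph α β) : Prop :=
  G.toSimpleGraph.Connected

/-- `T` is (the edge set of) a spanning tree of `G`: the spanning subgraph with edge set `T` is
connected and has exactly one edge less than vertices. -/
def IsSpanningTree (G : Graph α β) (T : Finset β) : Prop :=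
  (T : Set β) ⊆ G.edgeSet ∧ IsConnected (G.restrict (T : Set β)) ∧
    T.card + 1 = G.vertexSet.ncard

/-- `T` is a minimum weight spanning tree of `G` for the edge weights `c`. -/
def IsMinSpanningTree (G : Graph α β) (c : β → ℕ) (T : Finset β) : Prop :=
  IsSpanningTree G T ∧ ∀ T', IsSpanningTree G T' → ∑ e ∈ T, c e ≤ ∑ e ∈ T', c e

/-- For a sequence of trees (`B i` is the tree of index `i = 0, 1, 2, …`), the number of the first
`k` trees `B 0, …, B (k - 1)` that contain the edge `e`. -/
def load [DecidableEq β] (B : ℕ → Finset β) (k : ℕ) (e : β) : ℕ :=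
  ((Finset.range k).filter (fun i => e ∈ B i)).card

/-- The vector of relative loads `x^k` after packing `k` trees. -/
noncomputable def relLoad [DecidableEq β] (B : ℕ → Finset β) (k : ℕ) : β → ℝ :=
  fun e => (load B k e : ℝ) / (k : ℝ)

/-- `B` is a greedy tree packing of `G`: each tree is a minimum weight spanning tree for the loads
produced by the earlier trees. -/
def IsGreedyTreePacking [DecidableEq β] (G : Graph α β) (B : ℕ → Finset β) : Prop :=
  ∀ k, IsMinSpanningTree G (load B k) (B k)

/-- `B` is a greedy tree packing of `G` with ties broken by the edge ordering `idx`: among all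
minimum weight spanning trees, each step takes one whose total index is smallest. -/
def IsOrderedGreedyTreePacking [DecidableEq β] (G : Graph α β) (idx : β → ℕ)
    (B : ℕ → Finset β) : Prop :=
  IsGreedyTreePacking G B ∧
    ∀ k T, IsMinSpanningTree G (load B k) T → ∑ e ∈ B k, idx e ≤ ∑ e ∈ T, idx e

/-- `x` is the vector of ideal loads: the limit of the relative loads of the packing `B`. -/
def IsIdealLoads [DecidableEq β] (B : ℕ → Finset β) (x : β → ℝ) : Prop :=
  Tendsto (relLoad B) atTop (𝓝 x)

/-- The set of edges of `G` with one end in `S` and the other end outside `S`. -/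
def cut (G : Graph α β) (S : Set α) : Set β :=
  {e | ∃ x y, G.IsLink e x y ∧ x ∈ S ∧ y ∉ S}

/-- The edge connectivity `λ`: the smallest number of edges in a cut `∂S`, over all nonempty
proper subsets `S` of the vertex set. -/
noncomputable def edgeConnectivity (G : Graph α β) : ℕ :=
  sInf {c | ∃ S : Set α, S.Nonempty ∧ S ⊂ G.vertexSet ∧ c = (cut G S).ncard}

/-- The edges of the `2 × d` grid: the `d` rungs, and two rails between each pair of consecutive
columns. -/
abbrev LadderEdge (d : ℕ) : Type := Fin d ⊕ (Fin (d - 1) × Bool)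

/-- The ends of the edges of the `2 × d` grid, whose vertices are (column, row). -/
def ladderEnds (d : ℕ) : LadderEdge d → Sym2 (Fin d × Bool)
  | Sum.inl i => s((i, false), (i, true))
  | Sum.inr (i, b) => s((⟨i.1, by omega⟩, b), (⟨i.1 + 1, by omega⟩, b))

/-- The multigraph obtained from the `2 × d` grid by replacing every edge with `w` parallel
copies. -/
def ladder (d w : ℕ) : Graph (Fin d × Bool) (LadderEdge d × Fin w) where
  vertexSet := Set.univ
  IsLink e x y := ladderEnds d e.1 = s(x, y)
  isLink_symm := fun _ _ => ⟨fun _ _ h => h.trans Sym2.eq_swap⟩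
  eq_or_eq_of_isLink_of_isLink := by
    intro e x y v w h h'
    rw [h, Sym2.eq_iff] at h'
    tauto
  left_mem_of_isLink := fun _ _ _ _ => Set.mem_univ _

end TreePacking

/-!
The copies of the edges of `ladder d w` play no role: with the edges ordered column by column
(`baseIdx`) and the copies of an edge consecutively, the greedy packing is that of the simple ladder
with each tree repeated `w` times, once for each index of the copies (`multiTree`). That this is a
greedy packing with the right tie-breaking is a local check (`endsJoined_multi`): the ends of an edge
outside the current tree are joined by edges that are smaller in the lexicographic order by load and
position. By `sum_le_sum_of_endsJoined`, a spanning tree with this property has minimum weight, for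
the load as well as for the combination of load and position
(`isOrderedGreedyTreePacking_multiTree`).

The ideal loads are uniform. Every minimum weight tree weighs at most as much as the uniform
vector of the same total, because that vector is an average of spanning trees
(`mul_sum_le_of_isTree_min`). So the squared deviation of the loads from the uniform ones grows at
most linearly in time (`sum_sq_deviation_le`), and the relative loads converge
(`isIdealLoads_multiTree`).

The lower bound rests on a closed form for the loads of the simple ladder up to a time of order
`d ^ 2` (`baseLoad_add_dropCount`). A tree avoids `d - 1` edges, one for each cell. In a ladder
unbounded in both directions each edge would be avoided once in every three steps. The left end
carries a rung more than this pattern provides for, which makes the pattern pause there for one step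
at each pentagonal number `1, 5, 12, 22, …`; the pauses then travel to the right, and as long as they
have not reached the right end, the number of trees that avoid an edge is `(t + const - lag) / 3`,
rounded down, where the lag counts the pauses so far (`railDrop`, `rungDrop`). The closed form is
verified by induction: an edge whose count increases is the largest side of a cell, or nearly so
(`notMem_baseTree_of_dropCount_ne`), hence outside the tree, and the edges found in this way for
different cells are distinct (`avoidedEdge_injective`), hence all the edges outside the tree.

There are about `√(2 * t / 3)` pentagonal numbers up to `t`, so the load of the first rail exceeds
`2 * t / 3` by a multiple of `√t`, while `idealLoad d` exceeds `2 / 3` only by `O(1 / d)`. For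
`t ≤ (d - 1) ^ 2` the excess over the ideal load is therefore still of order `√t`
(`sqrt_le_deviation`). With `w` copies, the first copy of the first rail has after `k` trees the load
of that rail at a time `t ≥ k / w`, and the relative error is of order `√(k / w) / k = √(1 / (k * w))`
(`sqrt_le_norm_relLoad_sub`).
-/

namespace TreePacking

/-! ### Minimum spanning trees -/

section Kruskal

variable {V E : Type*}

/-- Two vertices are joined by the edge set `A` when a walk using only edges of `A` connects them.
Here a multigraph is given by the map `ends` sending each edge to its unordered pair of ends. -/
def Joined (ends : E → Sym2 V) (A : Set E) : V → V → Prop :=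
  Relation.EqvGen fun x y => ∃ e ∈ A, ends e = s(x, y)

/-- The two ends of the edge `e` are joined by the edge set `A`. -/
def EndsJoined (ends : E → Sym2 V) (A : Set E) (e : E) : Prop :=
  ∀ x y, ends e = s(x, y) → Joined ends A x y

/-- The edge set `T` is a spanning tree: it joins all vertices, and it has one edge less than there
are vertices. -/
def IsTree [Fintype V] (ends : E → Sym2 V) (T : Finset E) : Prop :=
  (∀ x y, Joined ends (T : Set E) x y) ∧ T.card + 1 = Fintype.card V

variable {ends : E → Sym2 V} {A B : Set E} {x y z : V} {e : E}

lemma Joined.refl (x : V) : Joined ends A x x := Relation.EqvGen.refl x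

lemma Joined.symm (h : Joined ends A x y) : Joined ends A y x := Relation.EqvGen.symm _ _ h

lemma Joined.trans (h : Joined ends A x y) (h' : Joined ends A y z) : Joined ends A x z :=
  Relation.EqvGen.trans _ _ _ h h'

lemma Joined.of_mem (he : e ∈ A) (h : ends e = s(x, y)) : Joined ends A x y :=
  Relation.EqvGen.rel _ _ ⟨e, he, h⟩

lemma endsJoined_of_mem (he : e ∈ A) : EndsJoined ends A e := fun _ _ h => .of_mem he h

/-- A walk in `A` can be replaced edge by edge by walks in `B`, possibly in another multigraph on
the same vertices. -/
lemma Joined.of_forall {E' : Type*} {ends' : E' → Sym2 V} {B : Set E'}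
    (hAB : ∀ e ∈ A, ∀ x y, ends e = s(x, y) → Joined ends' B x y) (h : Joined ends A x y) :
    Joined ends' B x y := by
  induction h with
  | rel x y h => obtain ⟨e, he, h⟩ := h; exact hAB e he x y h
  | refl x => exact .refl x
  | symm x y _ ih => exact ih.symm
  | trans x y z _ _ ih ih' => exact ih.trans ih'

lemma Joined.mono (hAB : A ⊆ B) (h : Joined ends A x y) : Joined ends B x y :=
  h.of_forall fun _ he => endsJoined_of_mem (hAB he)

lemma EndsJoined.mono (hAB : A ⊆ B) (h : EndsJoined ends A e) : EndsJoined ends B e :=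
  fun x y hxy => (h x y hxy).mono hAB

lemma endsJoined_of_joined (h : ends e = s(x, y)) (hj : Joined ends A x y) :
    EndsJoined ends A e := by
  intro x' y' h'
  rw [h, Sym2.eq_iff] at h'
  rcases h' with ⟨rfl, rfl⟩ | ⟨rfl, rfl⟩
  exacts [hj, hj.symm]

/-- If every edge outside `T` is bypassed by edges of smaller key, then it is bypassed by edges
of `T` of smaller key. -/
lemma endsJoined_of_forall_notMem (key : E → ℕ) (T : Set E)
    (h : ∀ e ∉ T, EndsJoined ends {f | key f < key e} e) (e : E) :
    EndsJoined ends {f | f ∈ T ∧ key f ≤ key e} e := by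
  induction hk : key e using Nat.strong_induction_on generalizing e with
  | _ n ih =>
    subst hk
    by_cases he : e ∈ T
    · exact endsJoined_of_mem ⟨he, le_rfl⟩
    · intro x y hxy
      refine (h e he x y hxy).of_forall fun f hf => ?_
      exact (ih _ hf f rfl).mono fun g hg => ⟨hg.1, hg.2.trans (le_of_lt hf)⟩

open Classical in
/-- Kruskal's tree for the edge order given by `key`: an edge belongs to it unless the edges of
smaller key already join its ends. -/
noncomputable def kruskal [Fintype E] (ends : E → Sym2 V) (key : E → ℕ) : Finset E :=
  Finset.univ.filter fun e => ¬ EndsJoined ends {f | key f < key e} e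

lemma mem_kruskal [Fintype E] {key : E → ℕ} :
    e ∈ kruskal ends key ↔ ¬ EndsJoined ends {f | key f < key e} e := by
  simp [kruskal]

lemma endsJoined_kruskal [Fintype E] (key : E → ℕ) (e : E) :
    EndsJoined ends {f | f ∈ kruskal ends key ∧ key f ≤ key e} e :=
  endsJoined_of_forall_notMem key (kruskal ends key : Set E)
    (fun e he => by simpa [mem_kruskal] using he) e

section Incidence

variable [DecidableEq V]

/-- The incidence vector of an edge over the field with two elements; it is `0` for a loop. -/
def incVec (ends : E → Sym2 V) (e : E) : V → ZMod 2 :=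
  Sym2.lift ⟨fun x y => Pi.single x 1 + Pi.single y 1, fun _ _ => add_comm _ _⟩ (ends e)

lemma incVec_eq (h : ends e = s(x, y)) : incVec ends e = Pi.single x 1 + Pi.single y 1 := by
  simp [incVec, h]

lemma single_add_single_self (x : V) :
    (Pi.single x 1 + Pi.single x 1 : V → ZMod 2) = 0 := by
  rw [← Pi.single_add, CharTwo.add_self_eq_zero, Pi.single_zero]

lemma Joined.mem_span (h : Joined ends A x y) :
    (Pi.single x 1 + Pi.single y 1 : V → ZMod 2) ∈ Submodule.span (ZMod 2) (incVec ends '' A) := by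
  induction h with
  | rel x y h =>
    obtain ⟨e, he, h⟩ := h
    exact Submodule.subset_span ⟨e, he, incVec_eq h⟩
  | refl x => rw [single_add_single_self]; exact Submodule.zero_mem _
  | symm x y _ ih => rwa [add_comm]
  | trans x y z _ _ ih ih' =>
    have := Submodule.add_mem _ ih ih'
    rwa [add_assoc, ← add_assoc (Pi.single y 1), single_add_single_self, zero_add] at this

variable [Fintype V]

lemma span_insert_eq_top (h : ∀ x y, Joined ends A x y) (x₀ : V) :
    Submodule.span (ZMod 2) (insert (Pi.single x₀ 1) (incVec ends '' A)) = ⊤ := by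
  rw [eq_top_iff, ← (Pi.basisFun (ZMod 2) V).span_eq, Submodule.span_le]
  rintro _ ⟨x, rfl⟩
  rw [Pi.basisFun_apply]
  have h1 := Submodule.span_mono (R := ZMod 2) (Set.subset_insert (Pi.single x₀ 1)
    (incVec ends '' A)) (h x x₀).mem_span
  have h2 : (Pi.single x₀ 1 : V → ZMod 2) ∈
      Submodule.span (ZMod 2) (insert (Pi.single x₀ 1) (incVec ends '' A)) :=
    Submodule.subset_span (Set.mem_insert _ _)
  have := Submodule.add_mem _ h1 h2
  rwa [add_assoc, single_add_single_self, add_zero] at this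

lemma card_le_of_joined [Nonempty V] {T : Finset E}
    (h : ∀ x y, Joined ends (T : Set E) x y) : Fintype.card V ≤ T.card + 1 := by
  classical
  obtain ⟨x₀⟩ := ‹Nonempty V›
  have h1 := span_insert_eq_top h x₀
  rw [← Finset.coe_image, ← Finset.coe_insert] at h1
  have h2 := finrank_span_finset_le_card (R := ZMod 2)
    (insert (Pi.single x₀ 1) (T.image (incVec ends)))
  rw [Set.finrank, h1, finrank_top, Module.finrank_fintype_fun_eq_card] at h2
  exact h2.trans ((Finset.card_insert_le _ _).trans (by gcongr; exact Finset.card_image_le))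

lemma IsTree.linearIndepOn [Nonempty V] {T : Finset E} (h : IsTree ends T) :
    LinearIndepOn (ZMod 2) (incVec ends) (T : Set E) := by
  obtain ⟨x₀⟩ := ‹Nonempty V›
  let v : Option T → V → ZMod 2 := fun o => o.elim (Pi.single x₀ 1) fun e => incVec ends e
  have hv : LinearIndependent (ZMod 2) v := by
    refine linearIndependent_of_top_le_span_of_card_eq_finrank ?_ ?_
    · rw [← span_insert_eq_top h.1 x₀]
      refine Submodule.span_mono ?_
      rintro _ (rfl | ⟨e, he, rfl⟩)
      · exact ⟨none, rfl⟩
      · exact ⟨some ⟨e, he⟩, rfl⟩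
    · simp [h.2]
  exact hv.comp some (Option.some_injective _)

/-- A spanning tree `T` that bypasses every edge of `S` by edges of no larger weight weighs no more
than `S`: each sublevel set of `S` is independent in the span of the corresponding sublevel set
of `T`. -/
lemma sum_le_sum_of_endsJoined {S T : Finset E} (c : E → ℕ) (hcard : S.card = T.card)
    (hS : LinearIndepOn (ZMod 2) (incVec ends) (S : Set E))
    (hT : ∀ e ∈ S, EndsJoined ends {f | f ∈ T ∧ c f ≤ c e} e) :
    ∑ e ∈ T, c e ≤ ∑ e ∈ S, c e := by
  classical
  have key : ∀ θ, (S.filter (c · ≤ θ)).card ≤ (T.filter (c · ≤ θ)).card := by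
    intro θ
    have hSθ : LinearIndepOn (ZMod 2) (incVec ends) (S.filter (c · ≤ θ) : Set E) :=
      hS.mono (by exact_mod_cast Finset.filter_subset _ _)
    have h1 : (S.filter (c · ≤ θ)).card = ((S.filter (c · ≤ θ)).image (incVec ends)).card := by
      rw [Finset.card_image_of_injOn hSθ.injOn]
    have h2 : LinearIndepOn (ZMod 2) id
        (((S.filter (c · ≤ θ)).image (incVec ends) : Finset _) : Set (V → ZMod 2)) := by
      rw [Finset.coe_image]; exact hSθ.id_image
    rw [h1, ← finrank_span_finset_eq_card h2]
    refine le_trans ?_ ((finrank_span_finset_le_card (R := ZMod 2)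
      ((T.filter (c · ≤ θ)).image (incVec ends))).trans Finset.card_image_le)
    refine Submodule.finrank_mono (Submodule.span_le.2 ?_)
    rw [Finset.coe_image, Finset.coe_image]
    rintro _ ⟨e, he, rfl⟩
    simp only [Finset.coe_filter, Set.mem_ofPred_eq] at he
    obtain ⟨x, y, hxy⟩ : ∃ x y, ends e = s(x, y) := by
      induction h : ends e with | _ x y => exact ⟨x, y, rfl⟩
    rw [incVec_eq hxy]
    refine ((hT e he.1 x y hxy).mono ?_).mem_span
    intro f hf
    simpa using ⟨hf.1, hf.2.trans he.2⟩
  have layer : ∀ (M : ℕ) (U : Finset E), (∀ e ∈ U, c e ≤ M) →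
      ∑ e ∈ U, c e + ∑ θ ∈ Finset.range M, (U.filter (c · ≤ θ)).card = M * U.card := by
    intro M U hU
    simp only [Finset.card_filter]
    rw [Finset.sum_comm, ← Finset.sum_add_distrib, mul_comm, ← smul_eq_mul, ← Finset.sum_const]
    refine Finset.sum_congr rfl fun e he => ?_
    have : ((Finset.range M).filter (c e ≤ ·)) = Finset.Ico (c e) M := by
      ext; simp [and_comm]
    rw [← Finset.card_filter, this, Nat.card_Ico]
    exact Nat.add_sub_cancel' (hU e he)
  let M := ∑ e ∈ S ∪ T, c e
  have hM : ∀ e ∈ S ∪ T, c e ≤ M := fun e he =>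
    Finset.single_le_sum (f := c) (fun _ _ => Nat.zero_le _) he
  have hS' := layer M S fun e he => hM e (Finset.mem_union_left _ he)
  have hT' := layer M T fun e he => hM e (Finset.mem_union_right _ he)
  have := Finset.sum_le_sum fun θ (_ : θ ∈ Finset.range M) => key θ
  rw [hcard] at hS'
  omega

/-- The indicator functional of the component of one end of `e` separates the incidence vector of
`e` from those of the edges of `A`. -/
lemma incVec_notMem_span (h : ¬ EndsJoined ends A e) :
    incVec ends e ∉ Submodule.span (ZMod 2) (incVec ends '' A) := by
  classical
  simp only [EndsJoined, not_forall] at h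
  obtain ⟨x, y, hxy, hj⟩ := h
  let φ : (V → ZMod 2) →ₗ[ZMod 2] ZMod 2 :=
    ∑ v : V, if Joined ends A x v then LinearMap.proj v else 0
  have hφ : ∀ v, φ (Pi.single v 1) = if Joined ends A x v then 1 else 0 := by
    intro v
    simp only [φ, LinearMap.sum_apply]
    rw [Finset.sum_eq_single v]
    · split_ifs <;> simp
    · intro b _ hb
      split_ifs <;> simp [hb]
    · simp
  intro hmem
  have hle : Submodule.span (ZMod 2) (incVec ends '' A) ≤ LinearMap.ker φ := by
    rw [Submodule.span_le]
    rintro _ ⟨f, hf, rfl⟩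
    obtain ⟨a, b, hab⟩ : ∃ a b, ends f = s(a, b) := by
      induction h : ends f with | _ a b => exact ⟨a, b, rfl⟩
    have hiff : Joined ends A x a ↔ Joined ends A x b :=
      ⟨fun h => h.trans (.of_mem hf hab), fun h => h.trans (Joined.of_mem hf hab).symm⟩
    rw [SetLike.mem_coe, LinearMap.mem_ker, incVec_eq hab, map_add, hφ, hφ]
    by_cases h : Joined ends A x b
    · rw [if_pos h, if_pos (hiff.2 h), CharTwo.add_self_eq_zero]
    · rw [if_neg h, if_neg (mt hiff.1 h), add_zero]
  have := hle hmem
  rw [LinearMap.mem_ker, incVec_eq hxy, map_add, hφ, hφ, if_pos (.refl x), if_neg hj] at this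
  simp at this

lemma linearIndepOn_kruskal [Fintype E] {key : E → ℕ} (hkey : Function.Injective key) :
    LinearIndepOn (ZMod 2) (incVec ends) (kruskal ends key : Set E) := by
  classical
  suffices ∀ S : Finset E, S ⊆ kruskal ends key →
      LinearIndepOn (ZMod 2) (incVec ends) (S : Set E) from this _ subset_rfl
  intro S
  induction S using Finset.induction_on_max_value key with
  | empty => simp
  | insert a s ha hmax ih =>
    intro hS
    rw [Finset.coe_insert]
    refine (ih ((Finset.subset_insert _ _).trans hS)).insert ?_
    have hak := mem_kruskal.1 (hS (Finset.mem_insert_self a s))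
    refine fun hmem => incVec_notMem_span hak (Submodule.span_mono ?_ hmem)
    refine Set.image_mono fun f hf => lt_of_le_of_ne (hmax f hf) fun h => ha ?_
    rwa [← hkey h]

/-- Incidence vectors have coordinate sum zero, so independent edge sets have fewer edges than
there are vertices. -/
lemma card_lt_of_linearIndepOn [Nonempty V] {T : Finset E}
    (h : LinearIndepOn (ZMod 2) (incVec ends) (T : Set E)) : T.card < Fintype.card V := by
  classical
  let φ : (V → ZMod 2) →ₗ[ZMod 2] ZMod 2 := ∑ v : V, LinearMap.proj v
  have hφ : ∀ v, φ (Pi.single v 1) = 1 := by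
    intro v
    simp [φ, LinearMap.sum_apply, Pi.single_apply]
  have hker : LinearMap.ker φ ≠ ⊤ := by
    intro htop
    obtain ⟨x₀⟩ := ‹Nonempty V›
    have : (Pi.single x₀ 1 : V → ZMod 2) ∈ LinearMap.ker φ := htop ▸ Submodule.mem_top
    rw [LinearMap.mem_ker, hφ] at this
    exact one_ne_zero this
  have h1 : T.card = (T.image (incVec ends)).card := by rw [Finset.card_image_of_injOn h.injOn]
  have h2 : LinearIndepOn (ZMod 2) id
      ((T.image (incVec ends) : Finset _) : Set (V → ZMod 2)) := by
    rw [Finset.coe_image]; exact h.id_image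
  rw [h1, ← finrank_span_finset_eq_card h2, ← Module.finrank_fintype_fun_eq_card (R := ZMod 2)]
  refine (Submodule.finrank_mono (Submodule.span_le.2 ?_)).trans_lt (Submodule.finrank_lt hker)
  rw [Finset.coe_image]
  rintro _ ⟨f, -, rfl⟩
  obtain ⟨a, b, hab⟩ : ∃ a b, ends f = s(a, b) := by
    induction h : ends f with | _ a b => exact ⟨a, b, rfl⟩
  rw [SetLike.mem_coe, LinearMap.mem_ker, incVec_eq hab, map_add, hφ, hφ,
    CharTwo.add_self_eq_zero]

lemma isTree_kruskal [Fintype E] [Nonempty V] {key : E → ℕ} (hkey : Function.Injective key)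
    (hconn : ∀ x y, Joined ends Set.univ x y) : IsTree ends (kruskal ends key) := by
  have h : ∀ x y, Joined ends (kruskal ends key : Set E) x y := fun x y =>
    (hconn x y).of_forall fun e _ => (endsJoined_kruskal key e).mono fun f hf => hf.1
  exact ⟨h, le_antisymm (card_lt_of_linearIndepOn (linearIndepOn_kruskal hkey))
    (card_le_of_joined h)⟩

end Incidence

end Kruskal

/-! ### Spanning trees of the ladder -/

section Ladder

/-- The ends of the edges of the ladder in which every edge has `w` parallel copies. -/
def multiEnds (d w : ℕ) (e : LadderEdge d × Fin w) : Sym2 (Fin d × Bool) := ladderEnds d e.1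

lemma ladder_isLink {d w : ℕ} {e : LadderEdge d × Fin w} {x y : Fin d × Bool} :
    (ladder d w).IsLink e x y ↔ multiEnds d w e = s(x, y) := Iff.rfl

lemma ladder_edgeSet (d w : ℕ) : (ladder d w).edgeSet = Set.univ := by
  rw [Set.eq_univ_iff_forall]
  intro e
  obtain ⟨x, y, h⟩ : ∃ x y, multiEnds d w e = s(x, y) := by
    induction h : multiEnds d w e with | _ x y => exact ⟨x, y, rfl⟩
  exact (ladder_isLink.2 h).edge_mem

lemma ladder_vertexSet_ncard (d w : ℕ) : (ladder d w).vertexSet.ncard = 2 * d := by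
  have : (ladder d w).vertexSet = Set.univ := rfl
  rw [this, Set.ncard_univ, Nat.card_eq_fintype_card]
  simp [mul_comm]

lemma ladder_edgeSet_ncard (d w : ℕ) :
    (ladder d w).edgeSet.ncard = (d + (d - 1) * 2) * w := by
  rw [ladder_edgeSet, Set.ncard_univ, Nat.card_eq_fintype_card]
  simp

lemma isConnected_restrict_iff {d w : ℕ} (hd : 1 ≤ d) (A : Set (LadderEdge d × Fin w)) :
    IsConnected ((ladder d w).restrict A) ↔ ∀ x y, Joined (multiEnds d w) A x y := by
  have hmem : ∀ x : Fin d × Bool, x ∈ ((ladder d w).restrict A).vertexSet := fun x =>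
    Set.mem_univ x
  constructor
  · intro h x y
    obtain ⟨p⟩ := h.preconnected ⟨x, hmem x⟩ ⟨y, hmem y⟩
    suffices ∀ u v : ((ladder d w).restrict A).vertexSet,
        ((ladder d w).restrict A).toSimpleGraph.Walk u v →
        Joined (multiEnds d w) A u v from this _ _ p
    intro u v q
    induction q with
    | nil => exact .refl _
    | cons hadj _ ih =>
      obtain ⟨-, e, he, hl⟩ := hadj
      exact (Joined.of_mem he (ladder_isLink.1 hl)).trans ih
  · intro h
    have : Nonempty ((ladder d w).restrict A).vertexSet := ⟨⟨(⟨0, hd⟩, false), hmem _⟩⟩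
    refine SimpleGraph.Connected.mk fun u v => ?_
    suffices ∀ x y, Joined (multiEnds d w) A x y →
        ((ladder d w).restrict A).toSimpleGraph.Reachable ⟨x, hmem x⟩ ⟨y, hmem y⟩ from
      this _ _ (h u v)
    intro x y hxy
    induction hxy with
    | rel x y h =>
      obtain ⟨e, he, hl⟩ := h
      by_cases hne : x = y
      · subst hne; exact .refl _
      · exact SimpleGraph.Adj.reachable ⟨fun h => hne (congrArg Subtype.val h), e, he, hl⟩
    | refl x => exact .refl _
    | symm x y _ ih => exact ih.symm
    | trans x y z _ _ ih ih' => exact ih.trans ih'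

lemma isSpanningTree_ladder_iff {d w : ℕ} (hd : 1 ≤ d) (T : Finset (LadderEdge d × Fin w)) :
    IsSpanningTree (ladder d w) T ↔ IsTree (multiEnds d w) T := by
  rw [IsSpanningTree, IsTree, isConnected_restrict_iff hd, ladder_vertexSet_ncard, ladder_edgeSet]
  simp [mul_comm]

/-- The column to the left of a cell. -/
def leftCol {d : ℕ} (c : Fin (d - 1)) : Fin d := ⟨c, by omega⟩

/-- The column to the right of a cell. -/
def rightCol {d : ℕ} (c : Fin (d - 1)) : Fin d := ⟨c + 1, by omega⟩

lemma ladderEnds_rung {d : ℕ} (p : Fin d) :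
    ladderEnds d (Sum.inl p) = s((p, false), (p, true)) := rfl

lemma ladderEnds_rail {d : ℕ} (c : Fin (d - 1)) (b : Bool) :
    ladderEnds d (Sum.inr (c, b)) = s((leftCol c, b), (rightCol c, b)) := rfl

lemma joined_row {d : ℕ} {A : Set (LadderEdge d)} {b : Bool}
    (h : ∀ c, Sum.inr (c, b) ∈ A) (i j : Fin d) : Joined (ladderEnds d) A (i, b) (j, b) := by
  have key : ∀ n (hn : n < d), Joined (ladderEnds d) A (⟨0, by omega⟩, b) (⟨n, hn⟩, b) := by
    intro n
    induction n with
    | zero => exact fun _ => .refl _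
    | succ n ih =>
      intro hn
      exact (ih (by omega)).trans (.of_mem (h ⟨n, by omega⟩) (ladderEnds_rail _ _))
  exact (key i i.2).symm.trans (key j j.2)

/-- The spanning tree of all rungs and the rails of one row. -/
def combTree (d : ℕ) (b : Bool) : Finset (LadderEdge d) :=
  Finset.univ.disjSum (Finset.univ.filter fun e => e.2 = b)

/-- The spanning tree of all rails and one rung. -/
def hTree (d : ℕ) (p : Fin d) : Finset (LadderEdge d) :=
  Finset.disjSum {p} Finset.univ

lemma sum_combTree {d : ℕ} (b : Bool) (c : LadderEdge d → ℕ) :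
    ∑ e ∈ combTree d b, c e = ∑ p, c (Sum.inl p) + ∑ i, c (Sum.inr (i, b)) := by
  rw [combTree, Finset.sum_disjSum]
  congr 1
  rw [Finset.sum_filter, Fintype.sum_prod_type]
  simp

lemma sum_hTree {d : ℕ} (p : Fin d) (c : LadderEdge d → ℕ) :
    ∑ e ∈ hTree d p, c e =
      c (Sum.inl p) + (∑ i, c (Sum.inr (i, false)) + ∑ i, c (Sum.inr (i, true))) := by
  rw [hTree, Finset.sum_disjSum, Fintype.sum_prod_type]
  simp [Finset.sum_add_distrib, add_comm]

lemma sum_ladderEdge {d : ℕ} (c : LadderEdge d → ℕ) :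
    ∑ e, c e = ∑ p, c (Sum.inl p) +
      (∑ i, c (Sum.inr (i, false)) + ∑ i, c (Sum.inr (i, true))) := by
  rw [Fintype.sum_sum_type, Fintype.sum_prod_type]
  simp [Finset.sum_add_distrib, add_comm]

lemma isTree_combTree {d : ℕ} (hd : 1 ≤ d) (b : Bool) : IsTree (ladderEnds d) (combTree d b) := by
  constructor
  · have hrow := joined_row (d := d) (A := (combTree d b : Set (LadderEdge d))) (b := b)
      fun c => by simp [combTree]
    have hrung : ∀ (i : Fin d) (a : Bool),
        Joined (ladderEnds d) (combTree d b : Set (LadderEdge d)) (i, a) (i, b) := by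
      intro i a
      have h : Joined (ladderEnds d) (combTree d b : Set (LadderEdge d)) (i, false) (i, true) :=
        .of_mem (by simp [combTree]) (ladderEnds_rung i)
      cases a <;> cases b
      exacts [.refl _, h, h.symm, .refl _]
    rintro ⟨i, a⟩ ⟨j, a'⟩
    exact ((hrung i a).trans (hrow i j)).trans (hrung j a').symm
  · have := sum_combTree (d := d) b fun _ => 1
    simp only [Finset.sum_const, smul_eq_mul, mul_one, Finset.card_univ, Fintype.card_fin] at this
    rw [this]
    simp
    omega

lemma isTree_hTree {d : ℕ} (p : Fin d) : IsTree (ladderEnds d) (hTree d p) := by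
  constructor
  · have hrow : ∀ b, ∀ i j : Fin d,
        Joined (ladderEnds d) (hTree d p : Set (LadderEdge d)) (i, b) (j, b) := fun b =>
      joined_row fun c => by simp [hTree]
    have h : Joined (ladderEnds d) (hTree d p : Set (LadderEdge d)) (p, false) (p, true) :=
      .of_mem (by simp [hTree]) (ladderEnds_rung p)
    have hcol : ∀ a a', Joined (ladderEnds d) (hTree d p : Set (LadderEdge d)) (p, a) (p, a') := by
      intro a a'
      cases a <;> cases a'
      exacts [.refl _, h, h.symm, .refl _]
    rintro ⟨i, a⟩ ⟨j, a'⟩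
    exact ((hrow a i p).trans (hcol a a')).trans (hrow a' p j)
  · have := sum_hTree p fun _ => 1
    simp only [Finset.sum_const, smul_eq_mul, mul_one, Finset.card_univ, Fintype.card_fin] at this
    rw [this]
    have := p.2
    simp
    omega

lemma joined_univ {d : ℕ} (hd : 1 ≤ d) (x y : Fin d × Bool) :
    Joined (ladderEnds d) Set.univ x y :=
  ((isTree_combTree hd false).1 x y).mono (Set.subset_univ _)

/-- The uniform vector lies in the spanning tree polytope: it is the average of the trees
`combTree` and `hTree`, where each `combTree` is taken `d - 1` times. So a tree that weighs no more
than each of these weighs no more than the uniform vector. -/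
lemma mul_sum_le_of_isTree_min {d : ℕ} (hd : 1 ≤ d) (c : LadderEdge d → ℕ) {W : ℕ}
    (hW : ∀ S, IsTree (ladderEnds d) S → W ≤ ∑ e ∈ S, c e) :
    (3 * (d - 1) + 1) * W ≤ (2 * (d - 1) + 1) * ∑ e, c e := by
  have hf := hW _ (isTree_combTree hd false)
  have ht := hW _ (isTree_combTree hd true)
  have hh := Finset.sum_le_sum fun p (_ : p ∈ Finset.univ) => hW _ (isTree_hTree (d := d) p)
  simp only [sum_hTree, Finset.sum_add_distrib, Finset.sum_const, smul_eq_mul, Finset.card_univ,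
    Fintype.card_fin] at hh
  rw [sum_combTree] at hf ht
  rw [sum_ladderEdge]
  obtain ⟨N, rfl⟩ : ∃ N, d = N + 1 := ⟨d - 1, by omega⟩
  simp only [Nat.add_sub_cancel] at *
  nlinarith [Nat.mul_le_mul_left N hf, Nat.mul_le_mul_left N ht]

end Ladder

/-! ### The packing of the ladder and its blow-up -/

section Packing

/-- The position of an edge of the ladder: column by column, in each column the rail of row `false`,
the rail of row `true`, and then the rung to the left of both. -/
def baseIdx {d : ℕ} : LadderEdge d → ℕ
  | Sum.inl p => 3 * p + 2
  | Sum.inr (c, b) => 3 * c + b.toNat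

lemma baseIdx_lt {d : ℕ} (e : LadderEdge d) : baseIdx e < 3 * d := by
  rcases e with p | ⟨c, b⟩
  · have := p.2; simp only [baseIdx]; omega
  · have := c.2; have := b.toNat_lt; simp only [baseIdx]; omega

lemma baseIdx_injective (d : ℕ) : Function.Injective (baseIdx (d := d)) := by
  rintro (p | ⟨c, b⟩) (p' | ⟨c', b'⟩) h <;> simp only [baseIdx] at h
  · congr 1; ext; omega
  · have := b'.toNat_lt; omega
  · have := b.toNat_lt; omega
  · have h1 := b.toNat_lt
    have h2 := b'.toNat_lt
    have hc : c = c' := by ext; omega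
    subst hc
    have hb : b.toNat = b'.toNat := by omega
    have : b = b' := by cases b <;> cases b' <;> simp_all
    rw [this]

/-- The lexicographic order by load and position, encoded as a natural number. -/
def lexKey {d : ℕ} (L : LadderEdge d → ℕ) (e : LadderEdge d) : ℕ := L e * (3 * d) + baseIdx e

lemma lexKey_lt_iff {d : ℕ} {L : LadderEdge d → ℕ} {e f : LadderEdge d} :
    lexKey L f < lexKey L e ↔ L f < L e ∨ L f = L e ∧ baseIdx f < baseIdx e := by
  have he := baseIdx_lt e
  have hf := baseIdx_lt f
  unfold lexKey
  constructor
  · intro h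
    rcases lt_trichotomy (L f) (L e) with h' | h' | h'
    · exact .inl h'
    · rw [h'] at h; exact .inr ⟨h', by omega⟩
    · have := Nat.mul_le_mul_right (3 * d) (Nat.succ_le_of_lt h')
      rw [Nat.succ_mul] at this
      omega
  · rintro (h' | ⟨h', h⟩)
    · have := Nat.mul_le_mul_right (3 * d) (Nat.succ_le_of_lt h')
      rw [Nat.succ_mul] at this
      omega
    · rw [h']; omega

lemma lexKey_injective {d : ℕ} (L : LadderEdge d → ℕ) : Function.Injective (lexKey L) := by
  intro e f h
  have h1 : ¬ lexKey L e < lexKey L f := by omega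
  have h2 : ¬ lexKey L f < lexKey L e := by omega
  rw [lexKey_lt_iff] at h1 h2
  refine baseIdx_injective d ?_
  omega

/-- The loads of the simple ladder after `t` steps of the greedy packing with ties broken by
`baseIdx`. -/
noncomputable def baseLoad (d : ℕ) : ℕ → LadderEdge d → ℕ
  | 0 => fun _ => 0
  | t + 1 => fun e =>
      baseLoad d t e + if e ∈ kruskal (ladderEnds d) (lexKey (baseLoad d t)) then 1 else 0

/-- The tree of index `t` in the greedy packing of the simple ladder with ties broken by
`baseIdx`. -/
noncomputable def baseTree (d t : ℕ) : Finset (LadderEdge d) :=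
  kruskal (ladderEnds d) (lexKey (baseLoad d t))

lemma baseLoad_succ (d t : ℕ) (e : LadderEdge d) :
    baseLoad d (t + 1) e = baseLoad d t e + if e ∈ baseTree d t then 1 else 0 := rfl

lemma isTree_baseTree {d : ℕ} (hd : 1 ≤ d) (t : ℕ) : IsTree (ladderEnds d) (baseTree d t) := by
  have : Nonempty (Fin d) := ⟨⟨0, hd⟩⟩
  exact isTree_kruskal (lexKey_injective _) (joined_univ hd)

lemma card_baseTree {d : ℕ} (hd : 1 ≤ d) (t : ℕ) : (baseTree d t).card = 2 * (d - 1) + 1 := by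
  have := (isTree_baseTree hd t).2
  simp at this
  omega

lemma mem_baseTree {d t : ℕ} {e : LadderEdge d} : e ∈ baseTree d t ↔
    ¬ EndsJoined (ladderEnds d) {f | lexKey (baseLoad d t) f < lexKey (baseLoad d t) e} e :=
  mem_kruskal

lemma sum_baseTree_le {d : ℕ} (hd : 1 ≤ d) (t : ℕ) (S : Finset (LadderEdge d))
    (hS : IsTree (ladderEnds d) S) :
    ∑ e ∈ baseTree d t, baseLoad d t e ≤ ∑ e ∈ S, baseLoad d t e := by
  have : Nonempty (Fin d) := ⟨⟨0, hd⟩⟩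
  refine sum_le_sum_of_endsJoined _ ?_ hS.linearIndepOn fun e _ => ?_
  · have h1 := hS.2
    have h2 := (isTree_baseTree hd t).2
    omega
  · refine (endsJoined_kruskal (lexKey (baseLoad d t)) e).mono fun f hf => ⟨hf.1, ?_⟩
    have := hf.2
    rw [← not_lt, lexKey_lt_iff] at this
    omega

/-- The common ideal load of the edges of the simple ladder. -/
noncomputable def idealLoad (d : ℕ) : ℝ := (2 * (d - 1 : ℕ) + 1) / (3 * (d - 1 : ℕ) + 1)

lemma idealLoad_nonneg (d : ℕ) : 0 ≤ idealLoad d := by unfold idealLoad; positivity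

lemma idealLoad_le_one (d : ℕ) : idealLoad d ≤ 1 := by
  unfold idealLoad
  rw [div_le_one (by positivity)]
  have : (0 : ℝ) ≤ (d - 1 : ℕ) := Nat.cast_nonneg _
  linarith

lemma card_ladderEdge {d : ℕ} (hd : 1 ≤ d) :
    Fintype.card (LadderEdge d) = 3 * (d - 1) + 1 := by
  simp
  omega

/-- The squared deviation from the ideal loads grows at most linearly: as the ideal loads lie in the
spanning tree polytope, a minimum weight tree has nonpositive inner product with the deviation. -/
lemma sum_sq_deviation_le {d : ℕ} (hd : 1 ≤ d) (t : ℕ) :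
    ∑ e, ((baseLoad d t e : ℝ) - t * idealLoad d) ^ 2 ≤ t * (3 * (d - 1 : ℕ) + 1) := by
  set x := idealLoad d with hx
  have hcard : (Fintype.card (LadderEdge d) : ℝ) = 3 * (d - 1 : ℕ) + 1 := by
    rw [card_ladderEdge hd]; push_cast; ring
  induction t with
  | zero => simp [baseLoad]
  | succ t ih =>
    let χ : LadderEdge d → ℝ := fun e => if e ∈ baseTree d t then 1 else 0
    have hstep : ∀ e, ((baseLoad d (t + 1) e : ℝ) - (t + 1 : ℕ) * x) ^ 2 =
        ((baseLoad d t e : ℝ) - t * x) ^ 2 +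
        (2 * (baseLoad d t e * χ e) - 2 * x * baseLoad d t e - 2 * (t * x) * (χ e - x)) +
        (χ e - x) ^ 2 := by
      intro e
      rw [baseLoad_succ]
      simp only [χ]
      push_cast
      ring
    have hχ : ∑ e, (χ e - x) = 0 := by
      rw [Finset.sum_sub_distrib, Finset.sum_const, Finset.card_univ, nsmul_eq_mul, hcard]
      have : ∑ e, χ e = (baseTree d t).card := by
        simp only [χ]
        rw [Finset.sum_ite_mem, Finset.univ_inter]
        simp
      rw [this, card_baseTree hd, hx, idealLoad, mul_div_cancel₀ _ (by positivity)]
      push_cast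
      ring
    have hLχ : ∑ e, (baseLoad d t e : ℝ) * χ e ≤ x * ∑ e, (baseLoad d t e : ℝ) := by
      have h1 : ∑ e, (baseLoad d t e : ℝ) * χ e =
          ((∑ e ∈ baseTree d t, baseLoad d t e : ℕ) : ℝ) := by
        simp only [χ, mul_ite, mul_one, mul_zero]
        rw [Finset.sum_ite_mem, Finset.univ_inter]
        push_cast
        rfl
      have h2 := mul_sum_le_of_isTree_min hd (baseLoad d t) (sum_baseTree_le hd t)
      rw [h1, hx, idealLoad, div_mul_eq_mul_div, le_div_iff₀ (by positivity), mul_comm]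
      exact_mod_cast h2
    have hsq : ∑ e, (χ e - x) ^ 2 ≤ 3 * (d - 1 : ℕ) + 1 := by
      rw [← hcard, ← Finset.card_univ, Finset.cast_card]
      refine Finset.sum_le_sum fun e _ => ?_
      have h0 := idealLoad_nonneg d
      have h1 := idealLoad_le_one d
      rw [← hx] at h0 h1
      simp only [χ]
      split_ifs <;> nlinarith
    simp only [hstep]
    rw [Finset.sum_add_distrib, Finset.sum_add_distrib, Finset.sum_sub_distrib,
      Finset.sum_sub_distrib, ← Finset.mul_sum, ← Finset.mul_sum, ← Finset.mul_sum, hχ]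
    push_cast
    nlinarith

lemma abs_deviation_le {d : ℕ} (hd : 1 ≤ d) (t : ℕ) (e : LadderEdge d) :
    |(baseLoad d t e : ℝ) - t * idealLoad d| ≤ √(t * (3 * (d - 1 : ℕ) + 1)) := by
  refine Real.abs_le_sqrt ((Finset.single_le_sum (f := fun e =>
    ((baseLoad d t e : ℝ) - t * idealLoad d) ^ 2) (fun _ _ => sq_nonneg _)
    (Finset.mem_univ e)).trans (sum_sq_deviation_le hd t))

/-- The packing of the ladder with `w` parallel edges in which each tree of the packing of the
simple ladder is repeated `w` times, using the copies of the edges in turn. -/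
noncomputable def multiTree (d w k : ℕ) : Finset (LadderEdge d × Fin w) :=
  Finset.univ.filter fun e => e.1 ∈ baseTree d (k / w) ∧ (e.2 : ℕ) = k % w

lemma mem_multiTree {d w k : ℕ} {e : LadderEdge d × Fin w} :
    e ∈ multiTree d w k ↔ e.1 ∈ baseTree d (k / w) ∧ (e.2 : ℕ) = k % w := by
  simp [multiTree]

lemma load_succ {β : Type*} [DecidableEq β] (B : ℕ → Finset β) (k : ℕ) (e : β) :
    load B (k + 1) e = load B k e + if e ∈ B k then 1 else 0 := by
  unfold load
  rw [Finset.range_add_one, Finset.filter_insert]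
  split_ifs with h
  · rw [Finset.card_insert_of_notMem (by simp)]
  · rfl

lemma load_multiTree {d w : ℕ} (k : ℕ) (e : LadderEdge d × Fin w) :
    load (multiTree d w) k e = baseLoad d (k / w) e.1 +
      if e.1 ∈ baseTree d (k / w) ∧ (e.2 : ℕ) < k % w then 1 else 0 := by
  have hw : 0 < w := e.2.pos
  have hj := e.2.2
  induction k with
  | zero => simp [load, baseLoad]
  | succ k ih =>
    rw [load_succ, ih]
    have hlt := Nat.mod_lt k hw
    have hdm := Nat.div_add_mod k w
    by_cases hr : k % w + 1 < w
    · have h1 : (k + 1) / w = k / w := by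
        have : k + 1 = w * (k / w) + (k % w + 1) := by omega
        rw [this, Nat.mul_add_div hw, Nat.div_eq_of_lt hr, add_zero]
      have h2 : (k + 1) % w = k % w + 1 := by
        have := Nat.div_add_mod (k + 1) w
        rw [h1] at this
        omega
      rw [h1, h2]
      by_cases hb : e.1 ∈ baseTree d (k / w)
      · simp only [mem_multiTree, hb, true_and]
        split_ifs <;> omega
      · simp [mem_multiTree, hb]
    · have h1 : (k + 1) / w = k / w + 1 := by
        have : k + 1 = w * (k / w + 1) := by rw [mul_add, mul_one]; omega
        rw [this, Nat.mul_div_cancel_left _ hw]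
      have h2 : (k + 1) % w = 0 := by
        have := Nat.div_add_mod (k + 1) w
        rw [h1, mul_add, mul_one] at this
        omega
      rw [h1, h2, baseLoad_succ]
      by_cases hb : e.1 ∈ baseTree d (k / w)
      · simp only [mem_multiTree, hb, true_and]
        split_ifs <;> omega
      · simp [mem_multiTree, hb]

lemma card_multiTree {d w : ℕ} (hw : 1 ≤ w) (k : ℕ) :
    (multiTree d w k).card = (baseTree d (k / w)).card := by
  have : multiTree d w k =
      (baseTree d (k / w)).map ⟨fun e => (e, ⟨k % w, Nat.mod_lt k hw⟩), fun _ _ h => by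
        simpa using h⟩ := by
    ext ⟨e, j⟩
    rw [mem_multiTree, Finset.mem_map]
    constructor
    · rintro ⟨h1, h2⟩
      exact ⟨e, h1, Prod.ext rfl (Fin.ext h2.symm)⟩
    · rintro ⟨a, h1, h2⟩
      cases h2
      exact ⟨h1, rfl⟩
  rw [this, Finset.card_map]

/-- A finite set can be numbered increasingly with respect to any injective function. -/
lemma exists_equiv_fin_strictMono {β : Type*} [Fintype β] (g : β → ℕ)
    (hg : Function.Injective g) :
    ∃ idx : β ≃ Fin (Fintype.card β), ∀ e f, g e < g f → (idx e : ℕ) < idx f := by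
  let _ : LinearOrder β := LinearOrder.lift' g hg
  refine ⟨(Fintype.orderIsoFinOfCardEq β rfl).symm.toEquiv, fun e f h => ?_⟩
  have : e < f := h
  exact_mod_cast (Fintype.orderIsoFinOfCardEq β rfl).symm.strictMono this

/-- In the ladder with parallel edges, an edge outside the tree of index `k` is bypassed by edges
that are smaller in the lexicographic order by load and position. -/
lemma endsJoined_multi {d w : ℕ} {idx : LadderEdge d × Fin w → ℕ}
    (hidx : ∀ e f : LadderEdge d × Fin w,
      baseIdx e.1 * w + (e.2 : ℕ) < baseIdx f.1 * w + (f.2 : ℕ) → idx e < idx f)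
    (k : ℕ) (e : LadderEdge d × Fin w) (he : e ∉ multiTree d w k) :
    EndsJoined (multiEnds d w) {f | load (multiTree d w) k f < load (multiTree d w) k e ∨
      load (multiTree d w) k f = load (multiTree d w) k e ∧ idx f < idx e} e := by
  have hw : 0 < w := e.2.pos
  let r : Fin w := ⟨k % w, Nat.mod_lt k hw⟩
  have hload : ∀ f, load (multiTree d w) k (f, r) = baseLoad d (k / w) f := by
    intro f; rw [load_multiTree]; simp [r]
  intro x y hxy
  by_cases hb : e.1 ∈ baseTree d (k / w)
  · -- the copy of the edge that lies in the tree is parallel to `e` and smaller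
    refine .of_mem (e := (e.1, r)) ?_ hxy
    have hne : (e.2 : ℕ) ≠ k % w := fun h => he (mem_multiTree.2 ⟨hb, h⟩)
    rw [Set.mem_ofPred_eq, hload, load_multiTree]
    rcases lt_or_gt_of_ne hne with h | h
    · left; simp [hb, h]
    · right
      refine ⟨by simp [h.not_gt], hidx _ _ ?_⟩
      simpa [r] using h
  · have h := mt mem_baseTree.2 hb
    rw [not_not] at h
    have h := h x y hxy
    have hle : load (multiTree d w) k e = baseLoad d (k / w) e.1 := by
      rw [load_multiTree]; simp [hb]
    refine h.of_forall fun f hf a b hab => .of_mem (e := (f, r)) ?_ hab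
    rw [Set.mem_ofPred_eq, lexKey_lt_iff] at hf
    rw [Set.mem_ofPred_eq, hload, hle]
    refine hf.imp_right fun hf => ⟨hf.1, hidx _ _ ?_⟩
    have := Nat.mul_le_mul_right w (Nat.succ_le_of_lt hf.2)
    rw [Nat.succ_mul] at this
    have hr := r.2
    simp only
    omega

/-- Adding the position to a large multiple of the load turns the lexicographic order into the order
of one weight, so the tree minimizes the load and, among the minimum weight trees, the total
position. -/
theorem isOrderedGreedyTreePacking_multiTree {d w : ℕ} (hd : 1 ≤ d) (hw : 1 ≤ w)
    {idx : LadderEdge d × Fin w → ℕ}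
    (hidx : ∀ e f : LadderEdge d × Fin w,
      baseIdx e.1 * w + (e.2 : ℕ) < baseIdx f.1 * w + (f.2 : ℕ) → idx e < idx f) :
    IsOrderedGreedyTreePacking (ladder d w) idx (multiTree d w) := by
  have : Nonempty (Fin d) := ⟨⟨0, hd⟩⟩
  let M := ∑ e, idx e + 1
  have hM : ∀ e, idx e < M := fun e => Nat.lt_succ_of_le
    (Finset.single_le_sum (f := idx) (fun _ _ => Nat.zero_le _) (Finset.mem_univ e))
  let key : ℕ → LadderEdge d × Fin w → ℕ := fun k e => load (multiTree d w) k e * M + idx e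
  have hlt : ∀ k e f, key k f < key k e ↔ load (multiTree d w) k f < load (multiTree d w) k e ∨
      load (multiTree d w) k f = load (multiTree d w) k e ∧ idx f < idx e := by
    intro k e f
    have he := hM e
    have hf := hM f
    simp only [key]
    rcases lt_trichotomy (load (multiTree d w) k f) (load (multiTree d w) k e) with h | h | h
    · have := Nat.mul_le_mul_right M (Nat.succ_le_of_lt h)
      rw [Nat.succ_mul] at this
      simp only [h, true_or, iff_true]
      omega
    · simp [h]
    · have := Nat.mul_le_mul_right M (Nat.succ_le_of_lt h)
      rw [Nat.succ_mul] at this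
      simp only [h.not_gt, h.ne', false_and, or_false, iff_false]
      omega
  have hjoin : ∀ k e, EndsJoined (multiEnds d w)
      {f | f ∈ multiTree d w k ∧ key k f ≤ key k e} e := fun k =>
    endsJoined_of_forall_notMem (key k) (multiTree d w k : Set _) fun e he =>
      (endsJoined_multi hidx k e (by simpa using he)).mono fun f hf => (hlt k e f).2 hf
  have htree : ∀ k, IsTree (multiEnds d w) (multiTree d w k) := by
    intro k
    refine ⟨fun x y => (joined_univ hd x y).of_forall fun e _ a b hab => ?_, ?_⟩
    · exact (hjoin k (e, ⟨0, hw⟩) a b hab).mono fun f hf => hf.1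
    · rw [card_multiTree hw, (isTree_baseTree hd _).2]
  have hle : ∀ k e f, key k f ≤ key k e →
      load (multiTree d w) k f ≤ load (multiTree d w) k e := by
    intro k e f h
    rw [← not_lt, hlt] at h
    omega
  have hsum : ∀ (c : ℕ → LadderEdge d × Fin w → ℕ),
      (∀ k e f, key k f ≤ key k e → c k f ≤ c k e) →
      ∀ k S, IsTree (multiEnds d w) S → ∑ e ∈ multiTree d w k, c k e ≤ ∑ e ∈ S, c k e := by
    intro c hc k S hS
    refine sum_le_sum_of_endsJoined _ ?_ hS.linearIndepOn fun e _ =>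
      (hjoin k e).mono fun f hf => ⟨hf.1, hc k e f hf.2⟩
    have h1 := hS.2
    have h2 := (htree k).2
    omega
  have hgreedy : IsGreedyTreePacking (ladder d w) (multiTree d w) := fun k =>
    ⟨(isSpanningTree_ladder_iff hd _).2 (htree k), fun S hS =>
      hsum (load (multiTree d w)) hle k S ((isSpanningTree_ladder_iff hd _).1 hS)⟩
  refine ⟨hgreedy, fun k S hS => ?_⟩
  have h1 := hsum key (fun _ _ _ h => h) k S ((isSpanningTree_ladder_iff hd _).1 hS.1)
  have h2 := hS.2 _ (hgreedy k).1
  simp only [key, Finset.sum_add_distrib, ← Finset.sum_mul] at h1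
  have h3 := Nat.mul_le_mul_right M h2
  omega

/-- The loads of the simple ladder deviate from their ideal values by the order of the square root
of time, so the relative loads of the blown-up packing converge. -/
theorem isIdealLoads_multiTree {d w : ℕ} (hd : 1 ≤ d) (hw : 1 ≤ w) :
    IsIdealLoads (multiTree d w) fun _ => idealLoad d / w := by
  rw [IsIdealLoads, tendsto_pi_nhds]
  intro e
  rw [tendsto_iff_norm_sub_tendsto_zero]
  set s : ℝ := √(3 * (d - 1 : ℕ) + 1) with hs
  have hbound : ∀ᶠ k : ℕ in atTop, ‖relLoad (multiTree d w) k e - idealLoad d / w‖ ≤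
      s / √(k : ℝ) + 2 / (k : ℝ) := by
    filter_upwards [eventually_ge_atTop 1] with k hk
    have hk' : (0 : ℝ) < k := by exact_mod_cast hk
    have hw' : (0 : ℝ) < w := by exact_mod_cast hw
    have hx0 := idealLoad_nonneg d
    have hx1 := idealLoad_le_one d
    have hdev := abs_le.1 (abs_deviation_le hd (k / w) e.1)
    have hsqrt : √((k / w : ℕ) * (3 * (d - 1 : ℕ) + 1)) ≤ √(k : ℝ) * s := by
      rw [hs, ← Real.sqrt_mul hk'.le]
      refine Real.sqrt_le_sqrt (mul_le_mul_of_nonneg_right ?_ (by positivity))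
      exact_mod_cast Nat.div_le_self k w
    have ht0 : ((k / w : ℕ) : ℝ) ≤ k / w := Nat.cast_div_le
    have ht1 : (k : ℝ) / w ≤ (k / w : ℕ) + 1 := by
      rw [div_le_iff₀ hw']
      have := (Nat.lt_div_mul_add hw (a := k)).le
      have h : (k : ℝ) ≤ (k / w : ℕ) * w + w := by exact_mod_cast this
      linarith
    have hδ : (baseLoad d (k / w) e.1 : ℝ) ≤ load (multiTree d w) k e ∧
        (load (multiTree d w) k e : ℝ) ≤ baseLoad d (k / w) e.1 + 1 := by
      rw [load_multiTree]
      constructor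
      · exact_mod_cast Nat.le_add_right _ _
      · push_cast
        split_ifs <;> simp
    have hmain : |(load (multiTree d w) k e : ℝ) - k / w * idealLoad d| ≤ √(k : ℝ) * s + 2 := by
      rw [abs_le]
      constructor <;> nlinarith
    have heq : relLoad (multiTree d w) k e - idealLoad d / w =
        ((load (multiTree d w) k e : ℝ) - k / w * idealLoad d) / k := by
      rw [relLoad]; field_simp
    rw [heq, Real.norm_eq_abs, abs_div, abs_of_pos hk', div_le_iff₀ hk']
    refine hmain.trans (le_of_eq ?_)
    have : √(k : ℝ) * √(k : ℝ) = k := Real.mul_self_sqrt hk'.le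
    have hpos : √(k : ℝ) ≠ 0 := (Real.sqrt_pos.2 hk').ne'
    have h1 : s / √(k : ℝ) * k = √(k : ℝ) * s := by
      rw [div_mul_eq_mul_div, div_eq_iff hpos]
      linear_combination (-s) * this
    rw [add_mul, h1, div_mul_cancel₀ _ hk'.ne']
  have hlim : Tendsto (fun k : ℕ => s / √(k : ℝ) + 2 / (k : ℝ)) atTop (𝓝 0) := by
    rw [show (0 : ℝ) = 0 + 0 by simp]
    refine Tendsto.add ?_ (tendsto_const_div_atTop_nhds_zero_nat 2)
    exact Tendsto.const_div_atTop
      (Real.tendsto_sqrt_atTop.comp tendsto_natCast_atTop_atTop) s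
  exact squeeze_zero' (Eventually.of_forall fun _ => norm_nonneg _) hbound hlim

end Packing

/-! ### Explicit loads up to quadratic time -/

section Dynamics

/-- The pentagonal numbers `0, 1, 5, 12, 22, …`. -/
def pent : ℕ → ℕ
  | 0 => 0
  | n + 1 => pent n + 3 * n + 1

lemma pent_succ (n : ℕ) : pent (n + 1) = pent n + 3 * n + 1 := rfl

lemma exists_pent_eq (n : ℕ) : ∃ z, pent n = n + 3 * z := by
  induction n with
  | zero => exact ⟨0, rfl⟩
  | succ n ih => obtain ⟨z, hz⟩ := ih; exact ⟨z + n, by rw [pent_succ]; omega⟩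

lemma two_mul_pent (n : ℕ) : 2 * pent n + n = 3 * n ^ 2 := by
  induction n with
  | zero => rfl
  | succ n ih => rw [pent_succ]; nlinarith

lemma le_pent (n : ℕ) : n ≤ pent n := by
  obtain ⟨z, hz⟩ := exists_pent_eq n
  omega

lemma pent_mono : Monotone pent := monotone_nat_of_le_succ fun n => by rw [pent_succ]; omega

/-- The number of positive pentagonal numbers that are at most `s`. -/
def pentRank (s : ℕ) : ℕ := Nat.findGreatest (fun n => pent n ≤ s) s

lemma pent_pentRank_le (s : ℕ) : pent (pentRank s) ≤ s :=
  Nat.findGreatest_spec (P := fun n => pent n ≤ s) (Nat.zero_le s) (Nat.zero_le s)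

lemma le_pentRank {s n : ℕ} (h : pent n ≤ s) : n ≤ pentRank s :=
  Nat.le_findGreatest ((le_pent n).trans h) h

lemma pentRank_lt {s n : ℕ} (h : s < pent n) : pentRank s < n := by
  by_contra! hn
  exact absurd ((pent_mono hn).trans (pent_pentRank_le s)) (by omega)

lemma lt_pent_pentRank_succ (s : ℕ) : s < pent (pentRank s + 1) := by
  by_contra! h
  have := le_pentRank h
  omega

lemma pentRank_eq {s n : ℕ} (h : pent n ≤ s) (h' : s < pent n + 3 * n + 1) : pentRank s = n := by
  have h1 := le_pentRank h
  have h2 := pentRank_lt (n := n + 1) (by rw [pent_succ]; exact h')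
  omega

/-- The delay, in steps, of the rails of cell `c` against the period 3 of an unbounded ladder. -/
def railLag (c t : ℕ) : ℕ := pentRank (t - 2 * c) - c

/-- The delay, in steps, of the rung of column `p` against the period 3 of an unbounded ladder. -/
def rungLag (p t : ℕ) : ℕ := pentRank (t + p + 1) - p

/-- The number of the first `t` trees that avoid a given rail of cell `c`; here `k` is `0` for the
row `false` and `1` for the row `true`. -/
def railDrop (c k t : ℕ) : ℕ := (t + k - railLag c t) / 3

/-- The number of the first `t` trees that avoid the rung of column `p`. -/
def rungDrop (p t : ℕ) : ℕ := (t + 2 - rungLag p t) / 3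

/-- Before time `pent (c + 1) - (c + 1)` the delay has not yet reached cell `c`. -/
lemma lags_early {c t : ℕ} (h : t + c + 1 < pent (c + 1)) :
    rungLag c t = 0 ∧ railLag c t = 0 ∧ rungLag (c + 1) t = 0 := by
  have h2 : pent (c + 2) = pent (c + 1) + 3 * (c + 1) + 1 := pent_succ _
  have a1 := pentRank_lt h
  have a2 := pentRank_lt (s := t - 2 * c) (n := c + 1) (by omega)
  have a3 := pentRank_lt (s := t + (c + 1) + 1) (n := c + 2) (by omega)
  unfold rungLag railLag
  omega

/-- The delays around cell `c` in its period of index `n`, of length `3 * n + 1`: the left rung is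
delayed first, then the rails, then the right rung. -/
lemma lags_eq {c t n u : ℕ} (hn : c + 1 ≤ n) (hu : u ≤ 3 * n) (ht : t + c + 1 = pent n + u) :
    rungLag c t = n - c ∧
    (u ≤ 3 * c ∧ railLag c t = n - c - 1 ∨ 3 * c < u ∧ railLag c t = n - c) ∧
    (u < 3 * n ∧ rungLag (c + 1) t = n - c - 1 ∨ u = 3 * n ∧ rungLag (c + 1) t = n - c) := by
  obtain ⟨k, rfl⟩ : ∃ k, n = k + 1 := ⟨n - 1, by omega⟩
  have h1 := pent_succ k
  have h2 : pent (k + 2) = pent (k + 1) + 3 * (k + 1) + 1 := pent_succ _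
  refine ⟨?_, ?_, ?_⟩
  · rw [rungLag, pentRank_eq (n := k + 1) (by omega) (by omega)]
  · rcases Nat.lt_or_ge (3 * c) u with h | h
    · right
      refine ⟨h, ?_⟩
      rw [railLag, pentRank_eq (n := k + 1) (by omega) (by omega)]
    · left
      refine ⟨h, ?_⟩
      rw [railLag, pentRank_eq (n := k) (by omega) (by omega)]
      omega
  · rcases Nat.lt_or_ge u (3 * (k + 1)) with h | h
    · left
      refine ⟨h, ?_⟩
      rw [rungLag, pentRank_eq (n := k + 1) (by omega) (by omega)]
      omega
    · right
      refine ⟨by omega, ?_⟩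
      rw [rungLag, pentRank_eq (n := k + 2) (by omega) (by omega)]
      omega

lemma early_or_exists_period (c t : ℕ) : t + c + 1 < pent (c + 1) ∨
    ∃ n u, c + 1 ≤ n ∧ u ≤ 3 * n ∧ t + c + 1 = pent n + u := by
  rcases Nat.lt_or_ge (t + c + 1) (pent (c + 1)) with h | h
  · exact .inl h
  · have h1 := pent_pentRank_le (t + c + 1)
    have h2 := lt_pent_pentRank_succ (t + c + 1)
    rw [pent_succ] at h2
    exact .inr ⟨pentRank (t + c + 1), t + c + 1 - pent (pentRank (t + c + 1)), le_pentRank h,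
      by omega, by omega⟩

lemma pentRank_mono : Monotone pentRank := fun _ _ h =>
  le_pentRank ((pent_pentRank_le _).trans h)

lemma pentRank_succ_le (s : ℕ) : pentRank (s + 1) ≤ pentRank s + 1 := by
  have h := lt_pent_pentRank_succ s
  have h2 : pent (pentRank s + 2) = pent (pentRank s + 1) + 3 * (pentRank s + 1) + 1 :=
    pent_succ _
  have := pentRank_lt (s := s + 1) (n := pentRank s + 2) (by omega)
  omega

lemma railLag_succ (c t : ℕ) :
    railLag c (t + 1) = railLag c t ∨ railLag c (t + 1) = railLag c t + 1 := by
  unfold railLag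
  rcases Nat.lt_or_ge t (2 * c) with h | h
  · left; rw [show t + 1 - 2 * c = 0 by omega, show t - 2 * c = 0 by omega]
  · rw [show t + 1 - 2 * c = t - 2 * c + 1 by omega]
    have h1 := pentRank_succ_le (t - 2 * c)
    have h2 := pentRank_mono (Nat.le_succ (t - 2 * c))
    rw [Nat.succ_eq_add_one] at h2
    omega

lemma rungLag_succ (p t : ℕ) :
    rungLag p (t + 1) = rungLag p t ∨ rungLag p (t + 1) = rungLag p t + 1 := by
  unfold rungLag
  rw [show t + 1 + p + 1 = t + p + 1 + 1 by omega]
  have h1 := pentRank_succ_le (t + p + 1)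
  have h2 := pentRank_mono (Nat.le_succ (t + p + 1))
  rw [Nat.succ_eq_add_one] at h2
  omega

lemma railDrop_succ (c k t : ℕ) :
    railDrop c k (t + 1) = railDrop c k t ∨ railDrop c k (t + 1) = railDrop c k t + 1 := by
  have := railLag_succ c t
  unfold railDrop
  omega

lemma rungDrop_succ (p t : ℕ) :
    rungDrop p (t + 1) = rungDrop p t ∨ rungDrop p (t + 1) = rungDrop p t + 1 := by
  have := rungLag_succ p t
  unfold rungDrop
  omega

/-- A rail of row `false` about to be avoided has been avoided less often than the other three sides
of its cell, so it has the largest load of them. -/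
lemma railDrop_false_lt {c t : ℕ} (h : railDrop c 0 (t + 1) ≠ railDrop c 0 t) :
    railDrop c 0 t < railDrop c 1 t ∧ railDrop c 0 t < rungDrop c t ∧
      railDrop c 0 t < rungDrop (c + 1) t := by
  have hs := railLag_succ c t
  unfold railDrop rungDrop at *
  rcases early_or_exists_period c t with he | ⟨n, u, hn, hu, ht⟩
  · have := lags_early he
    omega
  · have := lags_eq hn hu ht
    obtain ⟨z, hz⟩ := exists_pent_eq n
    omega

/-- A rail of row `true` about to be avoided follows the other sides of its cell in the order by load
and position, with the possible exception of the left rung; in that case it follows the other three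
sides of the preceding cell. -/
lemma railDrop_true_le {c t : ℕ} (h : railDrop c 1 (t + 1) ≠ railDrop c 1 t) :
    railDrop c 1 t ≤ railDrop c 0 t ∧ railDrop c 1 t < rungDrop (c + 1) t ∧
      (railDrop c 1 t < rungDrop c t ∨ ∃ b, c = b + 1 ∧ railDrop c 1 t ≤ rungDrop b t ∧
        railDrop c 1 t ≤ railDrop b 0 t ∧ railDrop c 1 t ≤ railDrop b 1 t) := by
  have hs := railLag_succ c t
  unfold railDrop rungDrop at *
  rcases early_or_exists_period c t with he | ⟨n, u, hn, hu, ht⟩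
  · have := lags_early he
    omega
  · have hl := lags_eq hn hu ht
    obtain ⟨z, hz⟩ := exists_pent_eq n
    refine ⟨by omega, by omega, ?_⟩
    rcases Nat.lt_or_ge (3 * c) u with hc | hc
    · left; omega
    · right
      obtain ⟨b, rfl⟩ : ∃ b, c = b + 1 := ⟨c - 1, by omega⟩
      have hb := lags_eq (c := b) (t := t) (n := n) (u := u - 1) (by omega) (by omega) (by omega)
      refine ⟨b, rfl, ?_⟩
      omega

/-- A rung about to be avoided is the largest side of the cell to its left or of the cell to its
right. The inequality `pent (p + 1) ≤ t + p` ensures that the latter cell exists as long as the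
delay has not reached the right end of the ladder. -/
lemma rungDrop_le {p t : ℕ} (h : rungDrop p (t + 1) ≠ rungDrop p t) :
    (∃ c, p = c + 1 ∧ rungDrop p t ≤ rungDrop c t ∧ rungDrop p t ≤ railDrop c 0 t ∧
      rungDrop p t ≤ railDrop c 1 t) ∨
    ((p = 0 ∨ pent (p + 1) ≤ t + p) ∧ rungDrop p t < rungDrop (p + 1) t ∧
      rungDrop p t ≤ railDrop p 0 t ∧ rungDrop p t ≤ railDrop p 1 t) := by
  have hm : (t + 2 - rungLag p t) % 3 = 2 := by
    have hs := rungLag_succ p t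
    unfold rungDrop at h
    omega
  clear h
  rcases Nat.eq_zero_or_pos p with rfl | hp
  · right
    rcases early_or_exists_period 0 t with he | ⟨n, u, hn, hu, ht⟩
    · simp [pent] at he
    · have hl := lags_eq hn hu ht
      obtain ⟨z, hz⟩ := exists_pent_eq n
      unfold railDrop rungDrop
      omega
  · obtain ⟨c, rfl⟩ : ∃ c, p = c + 1 := ⟨p - 1, by omega⟩
    rcases early_or_exists_period c t with he | ⟨n, u, hn, hu, ht⟩
    · left
      have := lags_early he
      unfold railDrop rungDrop
      exact ⟨c, rfl, by omega⟩
    · have hl := lags_eq hn hu ht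
      obtain ⟨z, hz⟩ := exists_pent_eq n
      have hu' : u % 3 = 0 ∧ u + 3 ≤ 3 * n := by omega
      rcases Nat.lt_or_ge (3 * c) u with hc | hc
      · right
        have hb := lags_eq (c := c + 1) (t := t) (n := n) (u := u + 1) (by omega) (by omega)
          (by omega)
        have hmono := pent_mono (show c + 1 + 1 ≤ n by omega)
        obtain ⟨hl, -, -⟩ := hl
        obtain ⟨hb1, hb2, hb3⟩ := hb
        replace hb2 : railLag (c + 1) t = n - (c + 1) := by omega
        replace hb3 : rungLag (c + 1 + 1) t = n - (c + 1) - 1 := by omega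
        unfold railDrop rungDrop
        rw [hb1, hb2, hb3]
        omega
      · left
        unfold railDrop rungDrop
        exact ⟨c, rfl, by omega⟩

/-- If neither rail of cell `c` is avoided at time `t`, then the cell avoids its left rung when that
has been avoided less often than the right one, and its right rung otherwise. -/
lemma rungDrop_succ_ne {c t : ℕ} (h0 : railDrop c 0 (t + 1) = railDrop c 0 t)
    (h1 : railDrop c 1 (t + 1) = railDrop c 1 t) :
    (rungDrop c t < rungDrop (c + 1) t ∧ rungDrop c (t + 1) ≠ rungDrop c t) ∨
    (rungDrop (c + 1) t ≤ rungDrop c t ∧ rungDrop (c + 1) (t + 1) ≠ rungDrop (c + 1) t) := by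
  unfold railDrop rungDrop at *
  rcases early_or_exists_period c t with he | ⟨n, u, hn, hu, ht⟩
  · have hl := lags_early he
    rcases Nat.lt_or_ge (t + 1 + c + 1) (pent (c + 1)) with he' | he'
    · have hl' := lags_early he'
      omega
    · have hl' := lags_eq (c := c) (t := t + 1) (n := c + 1) (u := 0) (by omega) (by omega)
        (by omega)
      omega
  · have hl := lags_eq hn hu ht
    obtain ⟨z, hz⟩ := exists_pent_eq n
    rcases Nat.lt_or_ge u (3 * n) with h | h
    · have hl' := lags_eq (c := c) (t := t + 1) (n := n) (u := u + 1) hn (by omega) (by omega)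
      omega
    · have hp := pent_succ n
      have hl' := lags_eq (c := c) (t := t + 1) (n := n + 1) (u := 0) (by omega) (by omega)
        (by omega)
      omega

/-- Two neighbouring cells never avoid the rung between them at the same time. -/
lemma not_rung_conflict {c t : ℕ} (h0 : railDrop c 0 (t + 1) = railDrop c 0 t)
    (h1 : railDrop c 1 (t + 1) = railDrop c 1 t) (hc : rungDrop (c + 1) t ≤ rungDrop c t)
    (h1' : railDrop (c + 1) 1 (t + 1) = railDrop (c + 1) 1 t) :
    rungDrop (c + 1 + 1) t ≤ rungDrop (c + 1) t := by
  have hp := pent_succ (c + 1)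
  unfold railDrop rungDrop at *
  by_cases he : t + (c + 1) + 1 < pent (c + 1 + 1)
  · have := lags_early he
    omega
  · rcases early_or_exists_period c t with he' | ⟨n, u, hn, hu, ht⟩
    · omega
    · obtain ⟨z, hz⟩ := exists_pent_eq n
      have hu' : u % 3 = 0 ∧ u ≤ 3 * c := by
        clear h1'
        have hl := lags_eq hn hu ht
        rcases Nat.lt_or_ge u (3 * n) with h | h
        · have hl' := lags_eq (c := c) (t := t + 1) (n := n) (u := u + 1) hn (by omega) (by omega)
          omega
        · have hp := pent_succ n
          have hl' := lags_eq (c := c) (t := t + 1) (n := n + 1) (u := 0) (by omega) (by omega)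
            (by omega)
          omega
      have hcn : c + 2 ≤ n := by
        by_contra! hcn
        obtain rfl : n = c + 1 := by omega
        omega
      clear h0 h1 hc
      have hb := lags_eq (c := c + 1) (t := t) (n := n) (u := u + 1) hcn (by omega) (by omega)
      have hb' := lags_eq (c := c + 1) (t := t + 1) (n := n) (u := u + 2) hcn (by omega) (by omega)
      replace hb : railLag (c + 1) t = n - (c + 1) - 1 := by omega
      replace hb' : railLag (c + 1) (t + 1) = n - (c + 1) - 1 := by omega
      omega

/-- The number of the first `t` trees that avoid an edge of the ladder. -/
def dropCount {d : ℕ} : LadderEdge d → ℕ → ℕ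
  | Sum.inl p, t => rungDrop p t
  | Sum.inr (c, b), t => railDrop c b.toNat t

lemma dropCount_zero {d : ℕ} (e : LadderEdge d) : dropCount e 0 = 0 := by
  rcases e with p | ⟨c, b⟩
  · simp only [dropCount, rungDrop]; omega
  · have := b.toNat_lt; simp only [dropCount, railDrop]; omega

lemma dropCount_succ {d : ℕ} (e : LadderEdge d) (t : ℕ) :
    dropCount e (t + 1) = dropCount e t ∨ dropCount e (t + 1) = dropCount e t + 1 := by
  rcases e with p | ⟨c, b⟩
  · exact rungDrop_succ p t
  · exact railDrop_succ c _ t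

section Cells

variable {d : ℕ} {A : Set (LadderEdge d)} (c : Fin (d - 1))

/-- The ends of the left rung of a cell are joined by the other three sides. -/
lemma joined_leftCol (hf : Sum.inr (c, false) ∈ A) (ht : Sum.inr (c, true) ∈ A)
    (hr : Sum.inl (rightCol c) ∈ A) :
    Joined (ladderEnds d) A (leftCol c, false) (leftCol c, true) :=
  ((Joined.of_mem hf (ladderEnds_rail c false)).trans (.of_mem hr (ladderEnds_rung _))).trans
    (Joined.of_mem ht (ladderEnds_rail c true)).symm

/-- The ends of the right rung of a cell are joined by the other three sides. -/
lemma joined_rightCol (hf : Sum.inr (c, false) ∈ A) (ht : Sum.inr (c, true) ∈ A)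
    (hl : Sum.inl (leftCol c) ∈ A) :
    Joined (ladderEnds d) A (rightCol c, false) (rightCol c, true) :=
  ((Joined.of_mem hf (ladderEnds_rail c false)).symm.trans
    (.of_mem hl (ladderEnds_rung _))).trans (.of_mem ht (ladderEnds_rail c true))

end Cells

/-- An edge whose explicit drop count increases at time `t` is the largest side of a cell, with one
exception: the left rung of the cell may be larger, but then it is in turn the largest side of the
preceding cell, whose other sides are smaller than the edge. -/
lemma notMem_baseTree_of_dropCount_ne {d t : ℕ} (hd : 2 ≤ d) (ht : t + d ≤ pent d)
    (hload : ∀ e, baseLoad d t e + dropCount e t = t) {e : LadderEdge d}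
    (he : dropCount e (t + 1) ≠ dropCount e t) : e ∉ baseTree d t := by
  rw [mem_baseTree, not_not]
  set A := {f | lexKey (baseLoad d t) f < lexKey (baseLoad d t) e} with hA
  have hmem : ∀ f, dropCount e t < dropCount f t ∨
      dropCount e t ≤ dropCount f t ∧ baseIdx f < baseIdx e → f ∈ A := by
    intro f hf
    rw [hA, Set.mem_ofPred_eq, lexKey_lt_iff]
    have h1 := hload e
    have h2 := hload f
    omega
  rcases e with p | ⟨c, b⟩
  · change rungDrop p (t + 1) ≠ rungDrop p t at he
    refine endsJoined_of_joined (ladderEnds_rung p) ?_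
    rcases rungDrop_le he with ⟨c, hp, h1, h2, h3⟩ | ⟨hp, h1, h2, h3⟩
    · have hc : c < d - 1 := by have := p.2; omega
      obtain rfl : p = rightCol ⟨c, hc⟩ := Fin.ext hp
      refine joined_rightCol ⟨c, hc⟩ (hmem _ (.inr ⟨h2, ?_⟩)) (hmem _ (.inr ⟨h3, ?_⟩))
        (hmem _ (.inr ⟨h1, ?_⟩))
      all_goals simp [baseIdx, rightCol, leftCol]
      all_goals omega
    · have hc : (p : ℕ) < d - 1 := by
        have := p.2
        by_contra! h
        have hpd : (p : ℕ) + 1 = d := by omega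
        rw [hpd] at hp
        omega
      obtain ⟨p, hp'⟩ := p
      refine joined_leftCol ⟨p, hc⟩ (hmem _ (.inr ⟨h2, ?_⟩)) (hmem _ (.inr ⟨h3, ?_⟩))
        (hmem _ (.inl h1))
      all_goals simp [baseIdx]
  · refine endsJoined_of_joined (ladderEnds_rail c b) ?_
    cases b
    · change railDrop c 0 (t + 1) ≠ railDrop c 0 t at he
      obtain ⟨h1, h2, h3⟩ := railDrop_false_lt he
      have hl : (Sum.inl (leftCol c) : LadderEdge d) ∈ A := hmem _ (.inl h2)
      have hr : (Sum.inl (rightCol c) : LadderEdge d) ∈ A := hmem _ (.inl h3)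
      have hb : (Sum.inr (c, true) : LadderEdge d) ∈ A := hmem _ (.inl h1)
      exact ((Joined.of_mem hl (ladderEnds_rung _)).trans (.of_mem hb (ladderEnds_rail c true))).trans
        (Joined.of_mem hr (ladderEnds_rung _)).symm
    · change railDrop c 1 (t + 1) ≠ railDrop c 1 t at he
      obtain ⟨h1, h2, h3⟩ := railDrop_true_le he
      have ha : (Sum.inr (c, false) : LadderEdge d) ∈ A :=
        hmem _ (.inr ⟨h1, by simp [baseIdx]⟩)
      have hr : (Sum.inl (rightCol c) : LadderEdge d) ∈ A := hmem _ (.inl h2)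
      have hl : Joined (ladderEnds d) A (leftCol c, false) (leftCol c, true) := by
        rcases h3 with h3 | ⟨b, hb, h4, h5, h6⟩
        · exact .of_mem (hmem (Sum.inl (leftCol c)) (.inl h3)) (ladderEnds_rung _)
        · have hb' : b < d - 1 := by have := c.2; omega
          have hcol : leftCol c = rightCol ⟨b, hb'⟩ := Fin.ext hb
          rw [hcol]
          refine joined_rightCol ⟨b, hb'⟩ (hmem _ (.inr ⟨h5, ?_⟩)) (hmem _ (.inr ⟨h6, ?_⟩))
            (hmem _ (.inr ⟨h4, ?_⟩)) <;> simp [baseIdx, leftCol] <;> omega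
      exact (hl.symm.trans (.of_mem ha (ladderEnds_rail c false))).trans
        (.of_mem hr (ladderEnds_rung _))

/-- The edge that cell `c` contributes to the complement of the tree of index `t`. -/
def avoidedEdge {d : ℕ} (t : ℕ) (c : Fin (d - 1)) : LadderEdge d :=
  if railDrop c 0 (t + 1) ≠ railDrop c 0 t then Sum.inr (c, false)
  else if railDrop c 1 (t + 1) ≠ railDrop c 1 t then Sum.inr (c, true)
  else if rungDrop c t < rungDrop (c + 1) t then Sum.inl (leftCol c)
  else Sum.inl (rightCol c)

lemma dropCount_avoidedEdge {d : ℕ} (t : ℕ) (c : Fin (d - 1)) :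
    dropCount (avoidedEdge t c) (t + 1) ≠ dropCount (avoidedEdge t c) t := by
  unfold avoidedEdge
  split_ifs with h0 h1 h2
  · exact h0
  · exact h1
  · rcases rungDrop_succ_ne (not_not.1 h0) (not_not.1 h1) with h | h
    · exact h.2
    · omega
  · rcases rungDrop_succ_ne (not_not.1 h0) (not_not.1 h1) with h | h
    · omega
    · exact h.2

lemma avoidedEdge_injective {d : ℕ} (t : ℕ) :
    Function.Injective (avoidedEdge (d := d) t) := by
  have conflict : ∀ c c' : Fin (d - 1), (c' : ℕ) = c + 1 →
      railDrop c 0 (t + 1) = railDrop c 0 t → railDrop c 1 (t + 1) = railDrop c 1 t →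
      ¬ rungDrop c t < rungDrop (c + 1) t → railDrop c' 1 (t + 1) = railDrop c' 1 t →
      ¬ rungDrop c' t < rungDrop (c' + 1) t := by
    intro c c' h h0 h1 h2 h1'
    rw [h] at h1' ⊢
    exact not_lt.2 (not_rung_conflict h0 h1 (not_lt.1 h2) h1')
  intro c c' h
  unfold avoidedEdge at h
  split_ifs at h with h0 h0' h1' h2' h1 h0' h1' h2' h2 h0' h1' h2' h0' h1' h2' <;>
    simp only [Sum.inr.injEq, Sum.inl.injEq, Prod.mk.injEq, leftCol, rightCol, Fin.mk.injEq,
      Bool.false_eq_true, Bool.true_eq_false, and_false, and_true] at h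
  · exact h
  · exact h
  · exact Fin.ext h
  · exact absurd h2 (conflict c' c h (not_not.1 h0') (not_not.1 h1') h2' (not_not.1 h1))
  · exact absurd h2' (conflict c c' h.symm (not_not.1 h0) (not_not.1 h1) h2 (not_not.1 h1'))
  · exact Fin.ext (by omega)

/-- Until the delay reaches the right end of the ladder, the explicit drop counts are those of the
greedy packing. -/
theorem baseLoad_add_dropCount {d : ℕ} (hd : 2 ≤ d) {t : ℕ} (ht : t + d ≤ pent d + 1)
    (e : LadderEdge d) : baseLoad d t e + dropCount e t = t := by
  induction t generalizing e with
  | zero => rw [dropCount_zero]; rfl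
  | succ t ih =>
    have ih := ih (by omega)
    have hnot := fun e => notMem_baseTree_of_dropCount_ne hd (t := t) (by omega) ih (e := e)
    have himage : Finset.univ.image (avoidedEdge (d := d) t) = (baseTree d t)ᶜ := by
      refine Finset.eq_of_subset_of_card_le ?_ ?_
      · intro f hf
        obtain ⟨c, -, rfl⟩ := Finset.mem_image.1 hf
        exact Finset.mem_compl.2 (hnot _ (dropCount_avoidedEdge t c))
      · rw [Finset.card_compl, card_baseTree (by omega), card_ladderEdge (by omega),
          Finset.card_image_of_injective _ (avoidedEdge_injective t), Finset.card_univ,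
          Fintype.card_fin]
        omega
    have h := ih e
    have hs := dropCount_succ e t
    rw [baseLoad_succ]
    by_cases he : e ∈ baseTree d t
    · have : dropCount e (t + 1) = dropCount e t := by
        by_contra hne
        exact hnot e hne he
      rw [if_pos he]
      omega
    · have : dropCount e (t + 1) ≠ dropCount e t := by
        rw [← Finset.mem_compl, ← himage] at he
        obtain ⟨c, -, rfl⟩ := Finset.mem_image.1 he
        exact dropCount_avoidedEdge t c
      rw [if_neg he]
      omega

end Dynamics

/-! ### Edge connectivity of the ladder -/

section Connectivity

lemma mem_cut_of_ends {d w : ℕ} {S : Set (Fin d × Bool)} {e : LadderEdge d × Fin w}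
    {x y : Fin d × Bool} (h : ladderEnds d e.1 = s(x, y)) (hxy : ¬ (x ∈ S ↔ y ∈ S)) :
    e ∈ cut (ladder d w) S := by
  by_cases hx : x ∈ S
  · exact ⟨x, y, h, hx, fun hy => hxy ⟨fun _ => hy, fun _ => hx⟩⟩
  · exact ⟨y, x, h.trans Sym2.eq_swap, by_contra fun hy => hxy ⟨fun h => absurd h hx,
      fun h => absurd h hy⟩, hx⟩

/-- Two distinct edges of the simple ladder cross each cut: two rungs, a rung and a rail, or the two
rails of a cell. -/
lemma exists_two_crossing {d : ℕ} (hd : 2 ≤ d) {S : Set (Fin d × Bool)} (hS : S.Nonempty)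
    (hS' : S ≠ Set.univ) : ∃ e f : LadderEdge d, e ≠ f ∧
      (∃ x y, ladderEnds d e = s(x, y) ∧ ¬ (x ∈ S ↔ y ∈ S)) ∧
      (∃ x y, ladderEnds d f = s(x, y) ∧ ¬ (x ∈ S ↔ y ∈ S)) := by
  -- a split column of a cell contributes its rung, and its neighbour a rung or a rail
  have hsplit : ∀ c : Fin (d - 1),
      (¬ ((leftCol c, false) ∈ S ↔ (leftCol c, true) ∈ S) ∨
        ¬ ((rightCol c, false) ∈ S ↔ (rightCol c, true) ∈ S)) →
      ∃ e f : LadderEdge d, e ≠ f ∧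
      (∃ x y, ladderEnds d e = s(x, y) ∧ ¬ (x ∈ S ↔ y ∈ S)) ∧
      (∃ x y, ladderEnds d f = s(x, y) ∧ ¬ (x ∈ S ↔ y ∈ S)) := by
    intro c h
    have hne : leftCol c ≠ rightCol c := by simp [leftCol, rightCol]
    by_cases hl : ((leftCol c, false) ∈ S ↔ (leftCol c, true) ∈ S)
    · have hr := h.resolve_left (not_not.2 hl)
      by_cases hf : ((leftCol c, false) ∈ S ↔ (rightCol c, false) ∈ S)
      · refine ⟨.inl (rightCol c), .inr (c, true), by simp, ⟨_, _, ladderEnds_rung _, hr⟩,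
          ⟨_, _, ladderEnds_rail _ _, ?_⟩⟩
        tauto
      · exact ⟨.inl (rightCol c), .inr (c, false), by simp, ⟨_, _, ladderEnds_rung _, hr⟩,
          ⟨_, _, ladderEnds_rail _ _, hf⟩⟩
    · by_cases hr : ((rightCol c, false) ∈ S ↔ (rightCol c, true) ∈ S)
      · by_cases hf : ((leftCol c, false) ∈ S ↔ (rightCol c, false) ∈ S)
        · refine ⟨.inl (leftCol c), .inr (c, true), by simp, ⟨_, _, ladderEnds_rung _, hl⟩,
            ⟨_, _, ladderEnds_rail _ _, ?_⟩⟩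
          tauto
        · exact ⟨.inl (leftCol c), .inr (c, false), by simp, ⟨_, _, ladderEnds_rung _, hl⟩,
            ⟨_, _, ladderEnds_rail _ _, hf⟩⟩
      · exact ⟨.inl (leftCol c), .inl (rightCol c), by simpa using hne,
          ⟨_, _, ladderEnds_rung _, hl⟩, ⟨_, _, ladderEnds_rung _, hr⟩⟩
  by_contra hno
  have hcell : ∀ c : Fin (d - 1),
      ((leftCol c, false) ∈ S ↔ (leftCol c, true) ∈ S) ∧
      ((rightCol c, false) ∈ S ↔ (rightCol c, true) ∈ S) := by
    intro c
    by_contra h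
    exact hno (hsplit c (by tauto))
  have hcol : ∀ p : Fin d, ((p, false) ∈ S ↔ (p, true) ∈ S) := by
    intro p
    by_cases hp : (p : ℕ) < d - 1
    · exact (hcell ⟨p, hp⟩).1
    · have hp' : (p : ℕ) - 1 < d - 1 := by omega
      have : p = rightCol ⟨(p : ℕ) - 1, hp'⟩ := by
        ext; have := p.2; simp [rightCol]; omega
      rw [this]
      exact (hcell _).2
  have hrail : ∀ c : Fin (d - 1), ((leftCol c, false) ∈ S ↔ (rightCol c, false) ∈ S) := by
    intro c
    by_contra h
    refine hno ⟨.inr (c, false), .inr (c, true), by simp, ⟨_, _, ladderEnds_rail _ _, h⟩,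
      ⟨_, _, ladderEnds_rail _ _, ?_⟩⟩
    rwa [← hcol, ← hcol]
  have hall : ∀ n (hn : n < d), ((⟨0, by omega⟩, false) ∈ S ↔ ((⟨n, hn⟩ : Fin d), false) ∈ S) := by
    intro n
    induction n with
    | zero => exact fun _ => Iff.rfl
    | succ n ih => exact fun hn => (ih (by omega)).trans (hrail ⟨n, by omega⟩)
  have hall' : ∀ x : Fin d × Bool, ((⟨0, by omega⟩, false) ∈ S ↔ x ∈ S) := by
    rintro ⟨p, b⟩
    cases b
    · exact hall p p.2
    · exact (hall p p.2).trans (hcol p)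
  obtain ⟨x, hx⟩ := hS
  exact hS' (Set.eq_univ_of_forall fun y => (hall' y).1 ((hall' x).2 hx))

theorem edgeConnectivity_ladder {d : ℕ} (hd : 2 ≤ d) (w : ℕ) :
    edgeConnectivity (ladder d w) = 2 * w := by
  have hpair : ∀ e f : LadderEdge d, e ≠ f →
      (({e, f} ×ˢ Finset.univ : Finset (LadderEdge d × Fin w)) :
        Set (LadderEdge d × Fin w)).ncard = 2 * w := by
    intro e f hef
    rw [Set.ncard_coe_finset, Finset.card_product, Finset.card_pair hef]
    simp
  apply le_antisymm
  · -- the two edges at a corner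
    refine Nat.sInf_le ⟨{(⟨0, by omega⟩, false)}, Set.singleton_nonempty _, ?_, ?_⟩
    · refine (Set.ssubset_univ_iff).2 fun h => ?_
      have : ((⟨0, by omega⟩, true) : Fin d × Bool) ∈
        ({(⟨0, by omega⟩, false)} : Set (Fin d × Bool)) := h ▸ Set.mem_univ _
      simp at this
    · rw [← hpair (.inl ⟨0, by omega⟩) (.inr (⟨0, by omega⟩, false)) (by simp)]
      congr 1
      ext ⟨e, j⟩
      simp only [Finset.coe_product, Finset.coe_univ, Set.mem_prod, Set.mem_univ, and_true,
        Finset.coe_insert, Finset.coe_singleton, Set.mem_insert_iff, Set.mem_singleton_iff]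
      constructor
      · rintro (rfl | rfl)
        · exact mem_cut_of_ends (ladderEnds_rung _) (by simp)
        · exact mem_cut_of_ends (ladderEnds_rail _ _) (by simp [leftCol, rightCol])
      · rintro ⟨x, y, h, hx, hy⟩
        obtain rfl := Set.mem_singleton_iff.1 hx
        change ladderEnds d e = _ at h
        rcases e with p | ⟨c, b⟩
        · rw [ladderEnds_rung, Sym2.eq_iff] at h
          left
          congr 1
          ext
          rcases h with ⟨h, -⟩ | ⟨-, h⟩
          · simpa using congrArg (fun z : Fin d × Bool => (z.1 : ℕ)) h
          · simpa using congrArg (fun z : Fin d × Bool => (z.1 : ℕ)) h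
        · rw [ladderEnds_rail, Sym2.eq_iff] at h
          right
          rcases h with ⟨h, -⟩ | ⟨-, h⟩
          · simp only [leftCol, Prod.mk.injEq, Fin.mk.injEq] at h
            obtain ⟨h1, rfl⟩ := h
            congr 2
            exact Fin.ext h1
          · simp [rightCol] at h
  · refine le_csInf ⟨_, {(⟨0, by omega⟩, false)}, Set.singleton_nonempty _, ?_, rfl⟩ ?_
    · refine (Set.ssubset_univ_iff).2 fun h => ?_
      have : ((⟨0, by omega⟩, true) : Fin d × Bool) ∈
        ({(⟨0, by omega⟩, false)} : Set (Fin d × Bool)) := h ▸ Set.mem_univ _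
      simp at this
    · rintro _ ⟨S, hS, hS', rfl⟩
      obtain ⟨e, f, hef, ⟨x, y, he, hxy⟩, ⟨x', y', hf, hxy'⟩⟩ :=
        exists_two_crossing hd hS ((Set.ssubset_univ_iff).1 hS')
      rw [← hpair e f hef]
      refine Set.ncard_le_ncard ?_ (Set.toFinite _)
      rintro ⟨g, j⟩ hg
      simp only [Finset.coe_product, Finset.coe_univ, Set.mem_prod, Set.mem_univ, and_true,
        Finset.coe_insert, Finset.coe_singleton, Set.mem_insert_iff, Set.mem_singleton_iff] at hg
      rcases hg with rfl | rfl
      · exact mem_cut_of_ends he hxy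
      · exact mem_cut_of_ends hf hxy'

end Connectivity

/-! ### The lower bound -/

section LowerBound

/-- The rail of the first cell in row `false`. -/
def firstRail {d : ℕ} (hd : 2 ≤ d) : LadderEdge d := Sum.inr (⟨0, by omega⟩, false)

lemma le_five_mul_pentRank_sq {t : ℕ} (ht : 1 ≤ t) : t ≤ 5 * pentRank t ^ 2 := by
  have h1 : 1 ≤ pentRank t := le_pentRank (by simpa [pent] using ht)
  have h2 := lt_pent_pentRank_succ t
  have h3 := two_mul_pent (pentRank t + 1)
  nlinarith

/-- The excess of the first rail over the ideal load is at least a constant times the square root of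
time: the rail is delayed once at each pentagonal number. -/
lemma sqrt_le_deviation {d : ℕ} (hd : 2 ≤ d) {t : ℕ} (ht : 1 ≤ t) (htd : t ≤ (d - 1) ^ 2) :
    √(t : ℝ) / 30 ≤ (baseLoad d t (firstRail hd) : ℝ) - t * idealLoad d := by
  obtain ⟨N, rfl⟩ : ∃ N, d = N + 1 := ⟨d - 1, by omega⟩
  have hN : 1 ≤ N := by omega
  rw [Nat.add_sub_cancel] at htd
  have hpent := two_mul_pent (N + 1)
  have hload := baseLoad_add_dropCount hd (t := t) (by nlinarith) (firstRail hd)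
  have hrank : pentRank t ≤ t := (le_pent _).trans (pent_pentRank_le t)
  have hdrop : 3 * dropCount (firstRail hd) t + pentRank t ≤ t := by
    change 3 * railDrop 0 0 t + pentRank t ≤ t
    simp only [railDrop, railLag, mul_zero, Nat.sub_zero, Nat.add_zero]
    omega
  have hL : 2 * (t : ℝ) + pentRank t ≤ 3 * baseLoad (N + 1) t (firstRail hd) := by
    have : 2 * t + pentRank t ≤ 3 * baseLoad (N + 1) t (firstRail hd) := by omega
    exact_mod_cast this
  have hν : (t : ℝ) ≤ 5 * (pentRank t : ℝ) ^ 2 := by exact_mod_cast le_five_mul_pentRank_sq ht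
  have hNt : (t : ℝ) ≤ (N : ℝ) ^ 2 := by exact_mod_cast htd
  have hN' : (1 : ℝ) ≤ N := by exact_mod_cast hN
  have hs0 := Real.sqrt_nonneg (t : ℝ)
  have hsq : √(t : ℝ) * √(t : ℝ) = t := Real.mul_self_sqrt (Nat.cast_nonneg t)
  have hsN : √(t : ℝ) ≤ N := Real.sqrt_le_iff.2 ⟨by linarith, hNt⟩
  have hsν : √(t : ℝ) ≤ 9 / 4 * pentRank t :=
    Real.sqrt_le_iff.2 ⟨by positivity, by nlinarith [sq_nonneg (pentRank t : ℝ)]⟩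
  have hx : idealLoad (N + 1) = 2 / 3 + 1 / (3 * (3 * (N : ℝ) + 1)) := by
    rw [idealLoad, Nat.add_sub_cancel]
    field_simp
    ring
  have hcorr : (t : ℝ) * (1 / (3 * (3 * (N : ℝ) + 1))) ≤ √(t : ℝ) / 9 := by
    rw [mul_one_div, div_le_div_iff₀ (by positivity) (by norm_num)]
    nlinarith [mul_le_mul_of_nonneg_left hsN hs0]
  rw [hx]
  linarith

/-- The first copy of an edge always has the load that the edge has in the simple ladder once its
current round is finished. -/
lemma exists_load_eq_baseLoad {d w : ℕ} (hw : 1 ≤ w) {k : ℕ} (hk : 1 ≤ k) (e : LadderEdge d) :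
    ∃ t, 1 ≤ t ∧ t ≤ k ∧ k ≤ t * w ∧
      load (multiTree d w) k (e, ⟨0, hw⟩) = baseLoad d t e := by
  have hdm := Nat.div_add_mod k w
  have hle := Nat.div_le_self k w
  rcases Nat.eq_zero_or_pos (k % w) with hr | hr
  · rw [hr, add_zero] at hdm
    refine ⟨k / w, ?_, hle, (hdm.symm.trans (mul_comm _ _)).le, ?_⟩
    · by_contra! h
      have h0 : k / w = 0 := Nat.lt_one_iff.1 h
      rw [h0] at hdm
      omega
    · rw [load_multiTree]; simp [hr]
  · have hmod := Nat.mod_lt k hw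
    refine ⟨k / w + 1, Nat.le_add_left _ _, ?_, by nlinarith, ?_⟩
    · have : 1 * (k / w) ≤ w * (k / w) := Nat.mul_le_mul_right _ hw
      omega
    · rw [load_multiTree, baseLoad_succ]
      simp [hr]

lemma sqrt_le_norm_relLoad_sub {d w : ℕ} (hd : 2 ≤ d) (hw : 1 ≤ w) {k : ℕ} (hk : 1 ≤ k)
    (hkd : k ≤ (d - 1) ^ 2) :
    √(1 / ((k : ℝ) * w)) / 30 ≤
      ‖relLoad (multiTree d w) k - fun _ => idealLoad d / (w : ℝ)‖ := by
  obtain ⟨t, ht1, htk, hkt, hload⟩ := exists_load_eq_baseLoad hw hk (firstRail hd)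
  refine le_trans ?_ (norm_le_pi_norm _ (firstRail hd, ⟨0, hw⟩))
  rw [Pi.sub_apply, relLoad, hload]
  refine le_trans ?_ (le_abs_self _)
  have hdev := sqrt_le_deviation hd ht1 (htk.trans hkd)
  have hk0 : (0 : ℝ) < k := by exact_mod_cast hk
  have hw0 : (0 : ℝ) < w := by exact_mod_cast hw
  have hx0 := idealLoad_nonneg d
  have hkt' : (k : ℝ) / w ≤ t := by
    rw [div_le_iff₀ hw0]
    exact_mod_cast hkt
  have hs : √(1 / ((k : ℝ) * w)) * k ≤ √(t : ℝ) := by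
    rw [← Real.sqrt_sq hk0.le, ← Real.sqrt_mul (by positivity), Real.sqrt_sq hk0.le]
    refine Real.sqrt_le_sqrt (le_trans (le_of_eq ?_) hkt')
    field_simp
  have heq : (baseLoad d t (firstRail hd) : ℝ) / k - idealLoad d / w =
      ((baseLoad d t (firstRail hd) : ℝ) - k / w * idealLoad d) / k := by
    field_simp
  rw [heq, le_div_iff₀ hk0]
  have := mul_le_mul_of_nonneg_right hkt' hx0
  linarith

end LowerBound

end TreePacking

theorem mainTheorem5 :
    ∃ c > (0 : ℝ), ∃ C > (0 : ℝ), ∀ d w : ℕ, 2 ≤ d → 1 ≤ w →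
      TreePacking.edgeConnectivity (TreePacking.ladder d w) = 2 * w ∧
      ∃ (idx : TreePacking.LadderEdge d × Fin w ≃
            Fin (Fintype.card (TreePacking.LadderEdge d × Fin w)))
        (B : ℕ → Finset (TreePacking.LadderEdge d × Fin w))
        (xs : TreePacking.LadderEdge d × Fin w → ℝ),
        TreePacking.IsOrderedGreedyTreePacking (TreePacking.ladder d w)
          (fun e => (idx e : ℕ)) B ∧
        TreePacking.IsIdealLoads B xs ∧
        ∀ k : ℕ, 1 ≤ k →
          (k : ℝ) ≤ C * ((TreePacking.ladder d w).vertexSet.ncard : ℝ) ^ 2 →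
          c * √(1 / ((k : ℝ) * (TreePacking.edgeConnectivity (TreePacking.ladder d w) : ℝ)))
              ≤ ‖TreePacking.relLoad B k - xs‖ ∧
          c * (√(6 * Real.log ((TreePacking.ladder d w).edgeSet.ncard : ℝ) /
                  ((k : ℝ) * (TreePacking.edgeConnectivity (TreePacking.ladder d w) : ℝ))) /
                √(Real.log ((TreePacking.ladder d w).edgeSet.ncard : ℝ)))
              ≤ ‖TreePacking.relLoad B k - xs‖ := by
  open TreePacking in
  refine ⟨1 / 60, by norm_num, 1 / 16, by norm_num, fun d w hd hw => ?_⟩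
  have hconn := edgeConnectivity_ladder hd w
  refine ⟨hconn, ?_⟩
  obtain ⟨idx, hidx⟩ := exists_equiv_fin_strictMono
    (fun e : LadderEdge d × Fin w => baseIdx e.1 * w + (e.2 : ℕ)) (by
      rintro ⟨e, i⟩ ⟨f, j⟩ h
      have hi := i.2
      have hj := j.2
      have hw' : 0 < w := hw
      have h1 : baseIdx e = baseIdx f := by
        have := congrArg (· / w) h
        simpa [Nat.add_div_of_dvd_right, Nat.div_eq_of_lt, hi, hj, hw'] using this
      have h2 : (i : ℕ) = j := by simp only [h1] at h; omega
      exact Prod.ext (baseIdx_injective d h1) (Fin.ext h2))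
  refine ⟨idx, multiTree d w, fun _ => idealLoad d / w,
    isOrderedGreedyTreePacking_multiTree (by omega) hw hidx,
    isIdealLoads_multiTree (by omega) hw, fun k hk hkC => ?_⟩
  have hkd : k ≤ (d - 1) ^ 2 := by
    rw [ladder_vertexSet_ncard] at hkC
    obtain ⟨N, rfl⟩ : ∃ N, d = N + 1 := ⟨d - 1, by omega⟩
    have hN : (1 : ℝ) ≤ N := by exact_mod_cast (show 1 ≤ N by omega)
    rw [Nat.add_sub_cancel]
    have : (k : ℝ) ≤ (N : ℝ) ^ 2 := by
      push_cast at hkC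
      nlinarith
    exact_mod_cast this
  have hmain := sqrt_le_norm_relLoad_sub hd hw hk hkd
  have hk0 : (0 : ℝ) < k := by exact_mod_cast hk
  have hw0 : (0 : ℝ) < w := by exact_mod_cast hw
  have hq := Real.sqrt_nonneg (1 / ((k : ℝ) * w))
  rw [hconn]
  push_cast
  constructor
  · have : √(1 / ((k : ℝ) * (2 * w))) ≤ √(1 / ((k : ℝ) * w)) := by
      refine Real.sqrt_le_sqrt (one_div_le_one_div_of_le (by positivity) ?_)
      nlinarith [mul_pos hk0 hw0]
    linarith
  · set l := Real.log ((ladder d w).edgeSet.ncard : ℝ) with hl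
    have hlog : 0 < l := by
      refine Real.log_pos ?_
      rw [ladder_edgeSet_ncard]
      have : 1 * 2 ≤ w * (d + (d - 1) * 2) := Nat.mul_le_mul hw (by omega)
      have : 1 < (d + (d - 1) * 2) * w := by rw [mul_comm]; omega
      exact_mod_cast this
    have h3 : √(6 * l / ((k : ℝ) * (2 * w))) / √l ≤ 2 * √(1 / ((k : ℝ) * w)) := by
      rw [← Real.sqrt_div' _ hlog.le]
      refine Real.sqrt_le_iff.2 ⟨by positivity, ?_⟩
      rw [mul_pow, Real.sq_sqrt (by positivity)]
      have : 6 * l / ((k : ℝ) * (2 * w)) / l = 3 * (1 / ((k : ℝ) * w)) := by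
        field_simp
        norm_num
      rw [this]
      have : 0 < 1 / ((k : ℝ) * w) := by positivity
      linarith
    linarith
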